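/- Let $(\Omega,\mathcal F,\mathbb P)$ be a probability space carrying two independent standard Brownian motions $B_1=(B_{1,t})_{t\in[0,1]}$ and $B_3=(B_{3,t})_{t\in[0,1]}$, let $\sigma_1,\sigma_2>0$ and $\rho\in(-1,1)$ be constants, and put $B_{2,t}=\rho B_{1,t}+\sqrt{1-\rho^2}\,B_{3,t}$. For $\ell=1,2$ let $b_\ell\in L^\infty([0,1]\times\Omega,\,dt\otimes\mathbb P)$ and let $X_\ell=(X_{\ell,t})_{t\in[0,1]}$ satisfy $$dX_{\ell,t}=\sigma_\ell\,dB_{\ell,t}+b_\ell(t,\omega)\,dt .$$ For $n\ge 1$ write $\Delta_k^nX_\ell=X_{\ell,k/n}-X_{\ell,(k-1)/n}$ and consider the realized correlation $$\varrho_1^n(X)=\frac{\sum_{k=1}^n\Delta_k^nX_1\,\Delta_k^nX_2}{\sqrt{\sum_{k=1}^n(\Delta_k^nX_1)^2\;\sum_{k=1}^n(\Delta_k^nX_2)^2}}$$ (with value $0$, say, if the denominator vanishes). Then $(\varrho_1^n(X))_{n\ge1}$ satisfies the large deviation principle on $\mathbb R$ with speed $n$ and with the good rate function $$I^\rho_{ldp}(u)=\begin{cases}\log\left(\dfrac{1-\rho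 u}{\sqrt{1-\rho^2}\,\sqrt{1-u^2}}\right), & -1<u<1,\\[2mm] +\infty, & \text{otherwise.}\end{cases}$$ That is, $I^\rho_{ldp}:\mathbb R\to[0,+\infty]$ has compact sub-level sets, and for every Borel set $A\subset\mathbb R$ $$-\inf_{u\in A^{o}} I^\rho_{ldp}(u)\le\liminf_{n\to\infty}\frac1n\log\mathbb P(\varrho_1^n(X)\in A)\le\limsup_{n\to\infty}\frac1n\log\mathbb P(\varrho_1^n(X)\in A)\le-\inf_{u\in\bar A} I^\rho_{ldp}(u).$$ -/

import Mathlib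

open MeasureTheory ProbabilityTheory Filter Topology
open scoped ENNReal

/-! ### Large deviation principle -/

/-- A rate function on `S`: it takes values in `[0, +∞]` and is lower semicontinuous, that is,
its sub-level sets are closed. -/
structure IsRateFunction {S : Type*} [TopologicalSpace S] (I : S → EReal) : Prop where
  nonneg : ∀ x, 0 ≤ I x
  isClosed_le : ∀ c : ℝ, 0 ≤ c → IsClosed {x | I x ≤ (c : EReal)}

/-- A good rate function: a rate function whose sub-level sets are compact. -/
structure IsGoodRateFunction {S : Type*} [TopologicalSpace S] (I : S → EReal) : Prop
    extends IsRateFunction I where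
  isCompact_le : ∀ c : ℝ, 0 ≤ c → IsCompact {x | I x ≤ (c : EReal)}

/-- The sequence `M` of `S`-valued random variables satisfies the large deviation principle with
speed `speed` and rate function `I`. Here `ENNReal.log 0 = -∞`, and an infimum over the empty set
is `+∞`. -/
structure SatisfiesLDP {Ω S : Type*} [MeasurableSpace Ω] [TopologicalSpace S] [MeasurableSpace S]
    (P : Measure Ω) (M : ℕ → Ω → S) (speed : ℕ → ℝ) (I : S → EReal) : Prop where
  speed_tendsto : Tendsto speed atTop atTop
  rate : IsRateFunction I
  lower : ∀ A : Set S, MeasurableSet A →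
    -(⨅ x ∈ interior A, I x) ≤
      liminf (fun n => ENNReal.log (P {ω | M n ω ∈ A}) / (speed n : EReal)) atTop
  upper : ∀ A : Set S, MeasurableSet A →
    limsup (fun n => ENNReal.log (P {ω | M n ω ∈ A}) / (speed n : EReal)) atTop ≤
      -(⨅ x ∈ closure A, I x)

/-! ### The model -/

/-- `B` is a standard Brownian motion on the time interval `[0, 1]`: it starts at `0`, has
independent increments, `B t - B s` has law `N(0, t - s)`, and almost all its paths are
continuous. The values of `B` outside `[0, 1]` play no role. -/
structure IsUnitBrownian {Ω : Type*} [MeasurableSpace Ω] (P : Measure Ω) (B : ℝ → Ω → ℝ) :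
    Prop where
  start : ∀ᵐ ω ∂P, B 0 ω = 0
  indep : HasIndepIncrements (fun (t : Set.Icc (0 : ℝ) 1) ω => B t ω) P
  law : ∀ s t : ℝ, 0 ≤ s → s ≤ t → t ≤ 1 →
    HasLaw (fun ω => B t ω - B s ω) (gaussianReal 0 (t - s).toNNReal) P
  cont : ∀ᵐ ω ∂P, ContinuousOn (fun t => B t ω) (Set.Icc 0 1)

/-- The processes `B` and `B'`, with times in `[0, 1]`, are independent. -/
def IndepUnitProcesses {Ω : Type*} [MeasurableSpace Ω] (P : Measure Ω) (B B' : ℝ → Ω → ℝ) : Prop :=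
  IndepFun (fun ω (t : Set.Icc (0 : ℝ) 1) => B t ω) (fun ω (t : Set.Icc (0 : ℝ) 1) => B' t ω) P

/-- The drift `b` belongs to `L^∞([0, 1] × Ω, dt ⊗ P)`. -/
def BoundedDrift {Ω : Type*} [MeasurableSpace Ω] (P : Measure Ω) (b : ℝ → Ω → ℝ) : Prop :=
  MemLp (fun p : ℝ × Ω => b p.1 p.2) ∞ ((volume.restrict (Set.Icc (0 : ℝ) 1)).prod P)

/-- `dX_t = σ dB_t + b(t, ω) dt` on `[0, 1]` with a constant `σ`, in integrated form
(the stochastic integral of a constant is `σ (B_t - B_0)`). -/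
def IsItoProcess {Ω : Type*} [MeasurableSpace Ω] (P : Measure Ω) (σ : ℝ) (B b X : ℝ → Ω → ℝ) :
    Prop :=
  ∀ t : ℝ, 0 ≤ t → t ≤ 1 →
    ∀ᵐ ω ∂P, X t ω = X 0 ω + σ * (B t ω - B 0 ω) + ∫ s in (0 : ℝ)..t, b s ω

/-! ### Realized (co-)volatility and realized correlation -/

/-- The increment `X_{k/n} - X_{(k-1)/n}`. -/
noncomputable def increment {Ω : Type*} (X : ℝ → Ω → ℝ) (n k : ℕ) (ω : Ω) : ℝ :=
  X ((k : ℝ) / n) ω - X (((k : ℝ) - 1) / n) ω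

/-- The realized covolatility `∑_{k = 1}^{[nt]} (Δ_k X) (Δ_k Y)`. -/
noncomputable def realizedCov {Ω : Type*} (X Y : ℝ → Ω → ℝ) (t : ℝ) (n : ℕ) (ω : Ω) : ℝ :=
  ∑ k ∈ Finset.Icc 1 ⌊(n : ℝ) * t⌋₊, increment X n k ω * increment Y n k ω

/-- The realized volatility `∑_{k = 1}^{[nt]} (Δ_k X)²`. -/
noncomputable def realizedVol {Ω : Type*} (X : ℝ → Ω → ℝ) (t : ℝ) (n : ℕ) (ω : Ω) : ℝ :=
  ∑ k ∈ Finset.Icc 1 ⌊(n : ℝ) * t⌋₊, increment X n k ω ^ 2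

/-- The realized correlation up to time `t` (with value `0` where a realized volatility
vanishes). -/
noncomputable def realizedCorr {Ω : Type*} (X Y : ℝ → Ω → ℝ) (t : ℝ) (n : ℕ) (ω : Ω) : ℝ :=
  realizedCov X Y t n ω / √(realizedVol X t n ω * realizedVol Y t n ω)

open Classical in
/-- The rate function of the realized correlation. -/
noncomputable def corrRate (ρ : ℝ) (u : ℝ) : EReal :=
  if -1 < u ∧ u < 1 then
    ((Real.log ((1 - ρ * u) / (√(1 - ρ ^ 2) * √(1 - u ^ 2))) : ℝ) : EReal)
  else ⊤

/-!
The realized correlation is a function of the Gram vector of the increments, which consists of the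
two realized volatilities and the realized covolatility. Without drift and with unit volatilities,
the Gram vector is a sum of `n` independent Gram vectors of Gaussian pairs with covariance matrix
`Σ / n`, `Σ = !![1, ρ; ρ, 1]`, so that its cumulant generating function at `n • t` is `n` times
`-½ log det (1 - 2 T Σ)`, where `T = !![t 0, t 1 / 2; t 1 / 2, t 2]`. Exponential tilting by
`T = ½ (Σ⁻¹ - S⁻¹)` replaces the covariance `Σ` by `S`; this yields the Gärtner–Ellis lower bound at
every positive definite `S`, as well as the exponents in the upper bound. Minimizing the resulting
rate `½ (tr (Σ⁻¹ S) - 2 - log det (Σ⁻¹ S))` over all `S` of correlation `u` gives `corrRate ρ u`.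

The correlation is a continuous function of the Gram vector only away from vanishing volatilities,
but volatilities below `δ` have a cost that tends to infinity as `δ → 0`. Likewise, a bounded drift
moves each of the `n` increments by `O(1 / n)`, hence the correlation by `O(1 / √n)` as long as the
volatilities stay above `δ`.
-/

open scoped Matrix

/-! ### The Gärtner–Ellis bounds -/

section ScaledCGF

variable {Ω ι : Type*} [Fintype ι] {mΩ : MeasurableSpace Ω} {P : Measure Ω} {r : ℝ}
  {Z : Ω → ι → ℝ} {Λ : (ι → ℝ) → ℝ} {D F U : Set (ι → ℝ)} {t z : ι → ℝ} {x : ℝ}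

theorem measurable_dotProduct_left (t : ι → ℝ) : Measurable fun z => t ⬝ᵥ z := by
  unfold dotProduct
  fun_prop

/-- The vector `Z` has exponential moments at `r • t` for all `t ∈ D`, with logarithm `r * Λ t`:
`Λ` is the cumulant generating function of `Z` scaled by the speed `r`. -/
structure HasScaledCGFOn (P : Measure Ω) (r : ℝ) (Z : Ω → ι → ℝ) (Λ : (ι → ℝ) → ℝ)
    (D : Set (ι → ℝ)) : Prop where
  aemeasurable : AEMeasurable Z P
  integrable_exp : ∀ t ∈ D, Integrable (fun ω => Real.exp (r * t ⬝ᵥ Z ω)) P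
  cgf_eq : ∀ t ∈ D, cgf (fun ω => t ⬝ᵥ Z ω) P r = r * Λ t

namespace HasScaledCGFOn

theorem integral_exp [NeZero P] (h : HasScaledCGFOn P r Z Λ D) (ht : t ∈ D) :
    ∫ ω, Real.exp (r * t ⬝ᵥ Z ω) ∂P = Real.exp (r * Λ t) := by
  rw [← h.cgf_eq t ht]
  exact (exp_cgf (h.integrable_exp t ht)).symm

theorem of_lintegral_exp (hZ : AEMeasurable Z P)
    (h : ∀ t ∈ D, ∫⁻ ω, ENNReal.ofReal (Real.exp (r * t ⬝ᵥ Z ω)) ∂P =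
      ENNReal.ofReal (Real.exp (r * Λ t))) :
    HasScaledCGFOn P r Z Λ D where
  aemeasurable := hZ
  integrable_exp t ht := by
    have := (measurable_dotProduct_left t).comp_aemeasurable hZ
    rw [← lintegral_ofReal_ne_top_iff_integrable (by fun_prop) (ae_of_all _ fun _ => by positivity),
      h t ht]
    exact ENNReal.ofReal_ne_top
  cgf_eq t ht := by
    have := (measurable_dotProduct_left t).comp_aemeasurable hZ
    rw [cgf, mgf, integral_eq_lintegral_of_nonneg_ae (ae_of_all _ fun _ => by positivity)
      (by fun_prop), h t ht, ENNReal.toReal_ofReal (Real.exp_pos _).le, Real.log_exp]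

theorem sum {κ : Type*} [Fintype κ] {Z : κ → Ω → ι → ℝ} {Λ : κ → (ι → ℝ) → ℝ}
    (hZ : iIndepFun Z P) (h : ∀ k, HasScaledCGFOn P r (Z k) (Λ k) D) :
    HasScaledCGFOn P r (∑ k, Z k) (∑ k, Λ k) D := by
  have := hZ.isProbabilityMeasure
  have hdot (t : ι → ℝ) :
      (fun ω => t ⬝ᵥ (∑ k, Z k) ω) = ∑ k, fun ω => t ⬝ᵥ Z k ω := by
    ext ω
    simp only [Finset.sum_apply, dotProduct_sum]
  have hmeas (t : ι → ℝ) (k : κ) : AEMeasurable (fun ω => t ⬝ᵥ Z k ω) P :=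
    (measurable_dotProduct_left t).comp_aemeasurable (h k).aemeasurable
  have hindep (t : ι → ℝ) : iIndepFun (fun k ω => t ⬝ᵥ Z k ω) P :=
    hZ.comp (fun _ z => t ⬝ᵥ z) fun _ => measurable_dotProduct_left t
  refine ⟨Finset.aemeasurable_sum _ fun k _ => (h k).aemeasurable, fun t ht => ?_, fun t ht => ?_⟩
  · refine mgf_pos_iff.1 ?_
    rw [hdot, (hindep t).mgf_sum₀ (hmeas t)]
    exact Finset.prod_pos fun k _ => mgf_pos ((h k).integrable_exp t ht)
  · rw [hdot, (hindep t).cgf_sum₀ (hmeas t) fun k _ => (h k).integrable_exp t ht,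
      Finset.sum_apply, Finset.mul_sum]
    exact Finset.sum_congr rfl fun k _ => (h k).cgf_eq t ht

theorem measureReal_le_dotProduct_le [IsFiniteMeasure P] (h : HasScaledCGFOn P r Z Λ D)
    (hr : 0 ≤ r) (ht : t ∈ D) (s : ℝ) :
    P.real {ω | s ≤ t ⬝ᵥ Z ω} ≤ Real.exp (-(r * (s - Λ t))) := by
  refine (measure_ge_le_exp_cgf s hr (h.integrable_exp t ht)).trans_eq ?_
  rw [h.cgf_eq t ht]
  ring_nf

theorem tilted [NeZero P] (h : HasScaledCGFOn P r Z Λ D) (ht : t ∈ D) :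
    HasScaledCGFOn (P.tilted fun ω => r * t ⬝ᵥ Z ω) r Z (fun s => Λ (t + s) - Λ t)
      {s | t + s ∈ D} where
  aemeasurable := h.aemeasurable.mono_ac (tilted_absolutelyContinuous P _)
  integrable_exp s hs := by
    rw [integrable_tilted_iff (h.integrable_exp t ht)]
    simpa only [smul_eq_mul, ← Real.exp_add, ← mul_add, ← add_dotProduct]
      using h.integrable_exp _ hs
  cgf_eq s hs := by
    have hadd : ((fun ω => r * t ⬝ᵥ Z ω) + fun ω => r * s ⬝ᵥ Z ω) =
        fun ω => r * (t + s) ⬝ᵥ Z ω := by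
      ext ω
      rw [Pi.add_apply, add_dotProduct, mul_add]
    rw [cgf, mgf, integral_exp_tilted, hadd, h.integral_exp hs, h.integral_exp ht, ← Real.exp_sub,
      Real.log_exp, mul_sub]

theorem tilted_real_le [IsFiniteMeasure P] [NeZero P] (h : HasScaledCGFOn P r Z Λ D) (hr : 0 ≤ r)
    (ht : t ∈ D) {s : ℝ} (hU : MeasurableSet U) (hs : ∀ y ∈ U, t ⬝ᵥ y ≤ s) :
    (P.tilted fun ω => r * t ⬝ᵥ Z ω).real {ω | Z ω ∈ U} ≤
      Real.exp (r * (s - Λ t)) * P.real {ω | Z ω ∈ U} := by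
  have hmeas : NullMeasurableSet {ω | Z ω ∈ U} P := h.aemeasurable.nullMeasurableSet_preimage hU
  have hdens : ∀ ω ∈ {ω | Z ω ∈ U}, ENNReal.ofReal (Real.exp (r * t ⬝ᵥ Z ω) /
      ∫ ω, Real.exp (r * t ⬝ᵥ Z ω) ∂P) ≤ ENNReal.ofReal (Real.exp (r * (s - Λ t))) := by
    intro ω hω
    rw [h.integral_exp ht, ← Real.exp_sub, mul_sub]
    gcongr
    exact hs _ hω
  have hle : (P.tilted fun ω => r * t ⬝ᵥ Z ω) {ω | Z ω ∈ U} ≤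
      ENNReal.ofReal (Real.exp (r * (s - Λ t))) * P {ω | Z ω ∈ U} := by
    rw [tilted_apply, ← setLIntegral_const]
    exact lintegral_mono_ae ((ae_restrict_iff'₀ hmeas).2 (ae_of_all _ hdens))
  have := ENNReal.toReal_mono (by finiteness) hle
  rwa [ENNReal.toReal_mul, ENNReal.toReal_ofReal (Real.exp_pos _).le] at this

end HasScaledCGFOn

theorem exists_finset_lt_dotProduct_sub_of_isCompact (hF : IsCompact F)
    (h : ∀ y ∈ F, ∃ t ∈ D, x < t ⬝ᵥ y - Λ t) :
    ∃ x' > x, ∃ T : Finset (ι → ℝ), ↑T ⊆ D ∧ ∀ y ∈ F, ∃ t ∈ T, x' < t ⬝ᵥ y - Λ t := by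
  classical
  refine hF.induction_on (p := fun G => ∃ x' > x, ∃ T : Finset (ι → ℝ), ↑T ⊆ D ∧
    ∀ y ∈ G, ∃ t ∈ T, x' < t ⬝ᵥ y - Λ t) ⟨x + 1, by simp, ∅, by simp, by simp⟩ ?_ ?_ ?_
  · rintro G G' hG ⟨x', hx', T, hT, hlt⟩
    exact ⟨x', hx', T, hT, fun y hy => hlt y (hG hy)⟩
  · rintro G G' ⟨x₁, hx₁, T₁, hT₁, hlt₁⟩ ⟨x₂, hx₂, T₂, hT₂, hlt₂⟩
    refine ⟨min x₁ x₂, lt_min hx₁ hx₂, T₁ ∪ T₂, by simp [hT₁, hT₂], ?_⟩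
    rintro y (hy | hy)
    · obtain ⟨t, ht, hlt⟩ := hlt₁ y hy
      exact ⟨t, Finset.mem_union_left _ ht, (min_le_left _ _).trans_lt hlt⟩
    · obtain ⟨t, ht, hlt⟩ := hlt₂ y hy
      exact ⟨t, Finset.mem_union_right _ ht, (min_le_right _ _).trans_lt hlt⟩
  · intro y hy
    obtain ⟨t, ht, hlt⟩ := h y hy
    obtain ⟨x', hx', hx'y⟩ := exists_between hlt
    have hopen : IsOpen {y | x' < t ⬝ᵥ y - Λ t} := isOpen_lt (by fun_prop) (by fun_prop)
    exact ⟨_, mem_nhdsWithin_of_mem_nhds (hopen.mem_nhds hx'y), x', hx', {t}, by simpa using ht,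
      fun y hy => ⟨t, Finset.mem_singleton_self t, hy⟩⟩

theorem exists_finset_eventually_cocompact_lt_dotProduct_sub (hD : D ∈ 𝓝 0) (x : ℝ) :
    ∃ T : Finset (ι → ℝ), ↑T ⊆ D ∧ ∀ᶠ y in cocompact (ι → ℝ), ∃ t ∈ T, x < t ⬝ᵥ y - Λ t := by
  classical
  obtain ⟨ε, hε, hball⟩ := Metric.nhds_basis_closedBall.mem_iff.1 hD
  let T : Finset (ι → ℝ) :=
    Finset.univ.image (fun i => Pi.single i ε) ∪ Finset.univ.image fun i => Pi.single i (-ε)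
  obtain ⟨M, hM⟩ : ∃ M, ∀ t ∈ T, Λ t ≤ M := by simpa using (T.image Λ).exists_le
  refine ⟨T, fun t ht => hball ?_, ?_⟩
  · have : ‖t‖ ≤ ε := by
      simp only [T, Finset.coe_union, Finset.coe_image, Finset.coe_univ, Set.image_univ,
        Set.mem_union, Set.mem_range] at ht
      obtain ⟨i, rfl⟩ | ⟨i, rfl⟩ := ht <;> simp [Pi.norm_single, abs_of_pos hε]
    simpa using this
  have hfar := tendsto_norm_cocompact_atTop (E := ι → ℝ) |>.eventually_gt_atTop
    (max ((x + M) / ε) 0)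
  filter_upwards [hfar] with y hy
  obtain ⟨i, hi⟩ : ∃ i, (x + M) / ε < |y i| := by
    by_contra! hle
    exact hy.not_ge ((pi_norm_le_iff_of_nonneg (le_max_right _ _)).2 fun i =>
      (hle i).trans (le_max_left _ _))
  rw [div_lt_iff₀ hε] at hi
  rcases abs_cases (y i) with ⟨habs, -⟩ | ⟨habs, -⟩ <;> rw [habs] at hi
  · have hmem : Pi.single i ε ∈ T := by simp [T]
    refine ⟨_, hmem, ?_⟩
    rw [single_dotProduct]
    linarith [hM _ hmem]
  · have hmem : Pi.single i (-ε) ∈ T := by simp [T]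
    refine ⟨_, hmem, ?_⟩
    rw [single_dotProduct]
    linarith [hM _ hmem]

theorem exists_finset_lt_dotProduct_sub (hF : IsClosed F) (hD : D ∈ 𝓝 0)
    (h : ∀ y ∈ F, ∃ t ∈ D, x < t ⬝ᵥ y - Λ t) :
    ∃ x' > x, ∃ T : Finset (ι → ℝ), ↑T ⊆ D ∧ ∀ y ∈ F, ∃ t ∈ T, x' < t ⬝ᵥ y - Λ t := by
  classical
  obtain ⟨T₁, hT₁, hfar⟩ :=
    exists_finset_eventually_cocompact_lt_dotProduct_sub (Λ := Λ) hD (x + 1)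
  obtain ⟨K, hK, hKfar⟩ := mem_cocompact.1 hfar
  obtain ⟨x', hx', T₂, hT₂, hnear⟩ :=
    exists_finset_lt_dotProduct_sub_of_isCompact (hK.inter_left hF) fun y hy => h y hy.1
  refine ⟨min (x + 1) x', lt_min (by linarith) hx', T₁ ∪ T₂, by simp [hT₁, hT₂], fun y hy => ?_⟩
  by_cases hyK : y ∈ K
  · obtain ⟨t, ht, hlt⟩ := hnear y ⟨hy, hyK⟩
    exact ⟨t, Finset.mem_union_right _ ht, (min_le_right _ _).trans_lt hlt⟩
  · obtain ⟨t, ht, hlt⟩ := hKfar hyK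
    exact ⟨t, Finset.mem_union_left _ ht, (min_le_left _ _).trans_lt hlt⟩

theorem eventually_const_mul_exp_le {x y : ℝ} (h : x < y) (C : ℝ) :
    ∀ᶠ n : ℕ in atTop, C * Real.exp (-(n * y)) ≤ Real.exp (-(n * x)) := by
  have hlim : Tendsto (fun n : ℕ => (n : ℝ) * (y - x)) atTop atTop :=
    tendsto_natCast_atTop_atTop.atTop_mul_const (sub_pos.2 h)
  filter_upwards [(Real.tendsto_exp_atTop.comp hlim).eventually_ge_atTop C] with n hn
  calc C * Real.exp (-(n * y)) ≤ Real.exp (n * (y - x)) * Real.exp (-(n * y)) := by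
        gcongr
        exact hn
    _ = Real.exp (-(n * x)) := by
        rw [← Real.exp_add]
        ring_nf

variable {μ : ℕ → Measure Ω} {Y : ℕ → Ω → ι → ℝ}

theorem exists_eventually_measureReal_isClosed_le [∀ n, IsFiniteMeasure (μ n)]
    (hY : ∀ᶠ n : ℕ in atTop, HasScaledCGFOn (μ n) n (Y n) Λ D) (hF : IsClosed F) (hD : D ∈ 𝓝 0)
    (h : ∀ y ∈ F, ∃ t ∈ D, x < t ⬝ᵥ y - Λ t) :
    ∃ x' > x, ∀ᶠ n : ℕ in atTop, (μ n).real {ω | Y n ω ∈ F} ≤ Real.exp (-(n * x')) := by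
  obtain ⟨x₁, hx₁, T, hTD, hT⟩ := exists_finset_lt_dotProduct_sub hF hD h
  obtain ⟨x', hx', hx'₁⟩ := exists_between hx₁
  refine ⟨x', hx', ?_⟩
  filter_upwards [hY, eventually_const_mul_exp_le hx'₁ T.card] with n hn hle
  have hcover : {ω | Y n ω ∈ F} ⊆ ⋃ t ∈ T, {ω | x₁ + Λ t ≤ t ⬝ᵥ Y n ω} := by
    intro ω hω
    obtain ⟨t, ht, hlt⟩ := hT _ hω
    exact Set.mem_biUnion ht (show x₁ + Λ t ≤ t ⬝ᵥ Y n ω by linarith)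
  calc (μ n).real {ω | Y n ω ∈ F}
      ≤ ∑ t ∈ T, (μ n).real {ω | x₁ + Λ t ≤ t ⬝ᵥ Y n ω} :=
        (measureReal_mono hcover (measure_ne_top _ _)).trans (measureReal_biUnion_finset_le T _)
    _ ≤ ∑ _t ∈ T, Real.exp (-(n * x₁)) := Finset.sum_le_sum fun t ht => by
        simpa using hn.measureReal_le_dotProduct_le n.cast_nonneg (hTD ht) (x₁ + Λ t)
    _ = T.card * Real.exp (-(n * x₁)) := by rw [Finset.sum_const, nsmul_eq_mul]
    _ ≤ Real.exp (-(n * x')) := hle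

variable [DecidableEq ι]

/-- A point other than the gradient of `Λ` at `0` is charged a positive cost, since
`s ↦ s * y i - Λ (s • eᵢ)` has no local maximum at `0` for a suitable `i`. -/
theorem exists_pos_dotProduct_sub (hD : D ∈ 𝓝 0) (hΛ : Λ 0 = 0)
    (hz : ∀ i, HasLineDerivAt ℝ Λ (z i) 0 (Pi.single i 1)) {y : ι → ℝ} (hy : y ≠ z) :
    ∃ t ∈ D, 0 < t ⬝ᵥ y - Λ t := by
  obtain ⟨i, hi⟩ := Function.ne_iff.1 hy
  have hderiv : HasDerivAt (fun s : ℝ => s * y i - Λ (0 + s • Pi.single i 1)) (y i - z i) 0 := by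
    simpa only [one_mul] using ((hasDerivAt_id' (0 : ℝ)).mul_const (y i)).fun_sub (hz i)
  have hline : Tendsto (fun s : ℝ => s • (Pi.single i 1 : ι → ℝ)) (𝓝 0) (𝓝 0) :=
    Continuous.tendsto' (by fun_prop) _ _ (zero_smul ℝ _)
  have hmax : ¬ IsLocalMax (fun s : ℝ => s * y i - Λ (0 + s • Pi.single i 1)) 0 := fun hmax =>
    sub_ne_zero.2 hi (hmax.hasDerivAt_eq_zero hderiv)
  obtain ⟨s, hs, hsD⟩ := ((not_eventually.1 hmax).and_eventually (hline.eventually_mem hD)).exists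
  refine ⟨_, hsD, ?_⟩
  simpa [hΛ, smul_dotProduct] using hs

theorem tendsto_measureReal_compl [∀ n, IsFiniteMeasure (μ n)]
    (hY : ∀ᶠ n : ℕ in atTop, HasScaledCGFOn (μ n) n (Y n) Λ D) (hD : D ∈ 𝓝 0) (hΛ : Λ 0 = 0)
    (hz : ∀ i, HasLineDerivAt ℝ Λ (z i) 0 (Pi.single i 1)) (hU : U ∈ 𝓝 z) :
    Tendsto (fun n => (μ n).real {ω | Y n ω ∉ U}) atTop (𝓝 0) := by
  obtain ⟨x, hx, hle⟩ := exists_eventually_measureReal_isClosed_le hY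
    (isOpen_interior (s := U)).isClosed_compl hD (x := 0) fun y hy =>
      exists_pos_dotProduct_sub hD hΛ hz fun h => hy (h ▸ mem_interior_iff_mem_nhds.2 hU)
  have hlim : Tendsto (fun n : ℕ => Real.exp (-(n * x))) atTop (𝓝 0) :=
    Real.tendsto_exp_neg_atTop_nhds_zero.comp (tendsto_natCast_atTop_atTop.atTop_mul_const hx)
  refine squeeze_zero' (.of_forall fun n => measureReal_nonneg) ?_ hlim
  filter_upwards [hle] with n hn
  refine (measureReal_mono ?_).trans hn
  exact fun ω hω hω' => hω (interior_subset hω')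

theorem tendsto_tilted_measureReal_compl [∀ n, NeZero (μ n)]
    (hY : ∀ᶠ n : ℕ in atTop, HasScaledCGFOn (μ n) n (Y n) Λ D) (hD : D ∈ 𝓝 t)
    (hz : ∀ i, HasLineDerivAt ℝ Λ (z i) t (Pi.single i 1)) (hU : U ∈ 𝓝 z) :
    Tendsto (fun n : ℕ => ((μ n).tilted fun ω => n * t ⬝ᵥ Y n ω).real {ω | Y n ω ∉ U}) atTop
      (𝓝 0) := by
  refine tendsto_measureReal_compl (hY.mono fun n hn => hn.tilted (mem_of_mem_nhds hD)) ?_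
    (by simp) (fun i => ?_) hU
  · exact (Continuous.tendsto' (by fun_prop) 0 t (add_zero t)).eventually_mem hD
  · simpa only [HasLineDerivAt, zero_add] using (hz i).sub_const (Λ t)

/-- Exposed points: tilting by `t` makes `z` the limit of `Y`, at the price `t ⬝ᵥ z - Λ t`. -/
theorem eventually_exp_le_measureReal [∀ n, IsProbabilityMeasure (μ n)]
    (hY : ∀ᶠ n : ℕ in atTop, HasScaledCGFOn (μ n) n (Y n) Λ D) (hD : D ∈ 𝓝 t)
    (hz : ∀ i, HasLineDerivAt ℝ Λ (z i) t (Pi.single i 1)) (hU : U ∈ 𝓝 z)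
    (hx : t ⬝ᵥ z - Λ t < x) :
    ∀ᶠ n : ℕ in atTop, Real.exp (-(n * x)) ≤ (μ n).real {ω | Y n ω ∈ U} := by
  obtain ⟨x', hx', hx'x⟩ := exists_between hx
  have hslab : IsOpen {y | t ⬝ᵥ y < x' + Λ t} := isOpen_lt (by fun_prop) (by fun_prop)
  set V := interior U ∩ {y | t ⬝ᵥ y < x' + Λ t}
  have hVmeas : MeasurableSet V := (isOpen_interior.inter hslab).measurableSet
  have hV : V ∈ 𝓝 z :=
    inter_mem (interior_mem_nhds.2 hU) (hslab.mem_nhds (by rw [Set.mem_ofPred_eq]; linarith))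
  have htD : t ∈ D := mem_of_mem_nhds hD
  let ν : ℕ → Measure Ω := fun n => (μ n).tilted fun ω => n * t ⬝ᵥ Y n ω
  filter_upwards [hY, eventually_const_mul_exp_le hx'x 2,
    (tendsto_tilted_measureReal_compl hY hD hz hV).eventually_le_const one_half_pos]
    with n hn hexp hhalf
  have : IsProbabilityMeasure (ν n) := isProbabilityMeasure_tilted (hn.integrable_exp t htD)
  have hmass : 1 / 2 ≤ (ν n).real {ω | Y n ω ∈ V} := by
    have hcompl : (ν n).real {ω | Y n ω ∉ V} = 1 - (ν n).real {ω | Y n ω ∈ V} :=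
      probReal_compl_eq_one_sub₀
        ((hn.tilted htD).aemeasurable.nullMeasurableSet_preimage hVmeas)
    linarith
  have hdens : (ν n).real {ω | Y n ω ∈ V} ≤ Real.exp (n * x') * (μ n).real {ω | Y n ω ∈ V} := by
    simpa using hn.tilted_real_le n.cast_nonneg htD hVmeas (s := x' + Λ t) fun y hy => hy.2.le
  calc Real.exp (-(n * x)) ≤ Real.exp (-(n * x')) * (1 / 2) := by linarith
    _ ≤ Real.exp (-(n * x')) * (Real.exp (n * x') * (μ n).real {ω | Y n ω ∈ V}) := by
        gcongr
        exact hmass.trans hdens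
    _ = (μ n).real {ω | Y n ω ∈ V} := by
        rw [← mul_assoc, ← Real.exp_add, neg_add_cancel, Real.exp_zero, one_mul]
    _ ≤ (μ n).real {ω | Y n ω ∈ U} := measureReal_mono fun ω hω => interior_subset (s := U) hω.1

end ScaledCGF

/-! ### The rate function -/

section RateFunction

variable {ρ u : ℝ}

/-- The finite part of `corrRate ρ`, which agrees with it on `(-1, 1)`. -/
noncomputable def corrRateReal (ρ u : ℝ) : ℝ :=
  Real.log ((1 - ρ * u) / (√(1 - ρ ^ 2) * √(1 - u ^ 2)))

theorem corrRate_of_mem (hu : u ∈ Set.Ioo (-1) 1) : corrRate ρ u = (corrRateReal ρ u : EReal) :=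
  if_pos hu

theorem corrRate_of_notMem (hu : u ∉ Set.Ioo (-1) 1) : corrRate ρ u = ⊤ :=
  if_neg hu

theorem one_sub_sq_pos (hu : u ∈ Set.Ioo (-1) 1) : 0 < 1 - u ^ 2 := by
  nlinarith [hu.1, hu.2]

theorem one_sub_mul_pos (hρ : ρ ∈ Set.Ioo (-1) 1) (hu : u ∈ Set.Icc (-1) 1) : 0 < 1 - ρ * u := by
  have hlt : |ρ * u| < 1 := by
    rw [abs_mul]
    exact mul_lt_one_of_nonneg_of_lt_one_left (abs_nonneg _) (abs_lt.2 hρ) (abs_le.2 hu)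
  linarith [le_abs_self (ρ * u)]

theorem corrRateReal_eq_half_log (hρ : ρ ∈ Set.Ioo (-1) 1) (hu : u ∈ Set.Ioo (-1) 1) :
    corrRateReal ρ u = Real.log ((1 - ρ * u) ^ 2 / ((1 - ρ ^ 2) * (1 - u ^ 2))) / 2 := by
  have hsq : (1 - ρ * u) ^ 2 / ((1 - ρ ^ 2) * (1 - u ^ 2)) =
      ((1 - ρ * u) / (√(1 - ρ ^ 2) * √(1 - u ^ 2))) ^ 2 := by
    rw [div_pow, mul_pow, Real.sq_sqrt (one_sub_sq_pos hρ).le, Real.sq_sqrt (one_sub_sq_pos hu).le]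
  rw [hsq, Real.log_pow, corrRateReal]
  push_cast
  ring

theorem lt_corrRateReal_iff (hρ : ρ ∈ Set.Ioo (-1) 1) (hu : u ∈ Set.Ioo (-1) 1) (x : ℝ) :
    x < corrRateReal ρ u ↔
      Real.exp (2 * x) * ((1 - ρ ^ 2) * (1 - u ^ 2)) < (1 - ρ * u) ^ 2 := by
  have h1 := one_sub_sq_pos hρ
  have h2 := one_sub_sq_pos hu
  have h3 := one_sub_mul_pos hρ (Set.Ioo_subset_Icc_self hu)
  rw [corrRateReal_eq_half_log hρ hu, lt_div_iff₀ two_pos, Real.lt_log_iff_exp_lt (by positivity),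
    lt_div_iff₀ (by positivity), mul_comm x]

theorem corrRateReal_nonneg (hρ : ρ ∈ Set.Ioo (-1) 1) (hu : u ∈ Set.Ioo (-1) 1) :
    0 ≤ corrRateReal ρ u := by
  have h1 := one_sub_sq_pos hρ
  have h2 := one_sub_sq_pos hu
  rw [corrRateReal_eq_half_log hρ hu]
  refine div_nonneg (Real.log_nonneg ?_) two_pos.le
  rw [one_le_div (by positivity)]
  nlinarith [sq_nonneg (u - ρ)]

theorem setOf_corrRate_le (hρ : ρ ∈ Set.Ioo (-1) 1) (x : ℝ) :
    {u | corrRate ρ u ≤ (x : EReal)} = Set.Icc (-1) 1 ∩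
      {u | (1 - ρ * u) ^ 2 ≤ Real.exp (2 * x) * ((1 - ρ ^ 2) * (1 - u ^ 2))} := by
  ext u
  simp only [Set.mem_ofPred_eq, Set.mem_inter_iff]
  by_cases hu : u ∈ Set.Ioo (-1) 1
  · rw [corrRate_of_mem hu, EReal.coe_le_coe_iff, ← not_lt, lt_corrRateReal_iff hρ hu, not_lt]
    simp [Set.Ioo_subset_Icc_self hu]
  · rw [corrRate_of_notMem hu, top_le_iff]
    refine iff_of_false (EReal.coe_ne_top _) ?_
    rintro ⟨hu', hle⟩
    have hsq : 1 ≤ u ^ 2 := by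
      by_contra! h
      exact hu (abs_lt.1 ((sq_lt_one_iff_abs_lt_one u).1 h))
    have hnonpos := mul_nonpos_of_nonneg_of_nonpos (Real.exp_pos (2 * x)).le
      (mul_nonpos_of_nonneg_of_nonpos (one_sub_sq_pos hρ).le (sub_nonpos.2 hsq))
    exact (pow_pos (one_sub_mul_pos hρ hu') 2).not_ge (hle.trans hnonpos)

theorem isCompact_setOf_corrRate_le (hρ : ρ ∈ Set.Ioo (-1) 1) (x : ℝ) :
    IsCompact {u | corrRate ρ u ≤ (x : EReal)} := by
  rw [setOf_corrRate_le hρ]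
  exact isCompact_Icc.inter_right (isClosed_le (by fun_prop) (by fun_prop))

theorem isGoodRateFunction_corrRate (hρ : ρ ∈ Set.Ioo (-1) 1) :
    IsGoodRateFunction (corrRate ρ) where
  nonneg u := by
    by_cases hu : u ∈ Set.Ioo (-1) 1
    · rw [corrRate_of_mem hu]
      exact_mod_cast corrRateReal_nonneg hρ hu
    · rw [corrRate_of_notMem hu]
      exact le_top
  isClosed_le x _ := (isCompact_setOf_corrRate_le hρ x).isClosed
  isCompact_le x _ := isCompact_setOf_corrRate_le hρ x

theorem exists_lt_corrRateReal (hρ : ρ ∈ Set.Ioo (-1) 1) {x : ℝ} (hx : (x : EReal) < corrRate ρ u) :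
    ∃ w ∈ Set.Ioo (-1 : ℝ) 1, x < corrRateReal ρ w ∧ 0 ≤ (w - ρ) * (u - w) := by
  by_cases hu : u ∈ Set.Ioo (-1) 1
  · exact ⟨u, hu, by simpa [corrRate_of_mem hu] using hx, by simp⟩
  have hopen : IsOpen {w | Real.exp (2 * x) * ((1 - ρ ^ 2) * (1 - w ^ 2)) < (1 - ρ * w) ^ 2} :=
    isOpen_lt (by fun_prop) (by fun_prop)
  have hend : ∀ e ∈ Set.Icc (-1 : ℝ) 1, e ^ 2 = 1 →
      ∀ᶠ w in 𝓝 e, Real.exp (2 * x) * ((1 - ρ ^ 2) * (1 - w ^ 2)) < (1 - ρ * w) ^ 2 :=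
    fun e he he' => hopen.mem_nhds (by simp [he', (one_sub_mul_pos hρ he).ne', sq_pos_iff])
  simp only [Set.mem_Ioo, not_and_or, not_lt] at hu
  obtain hu | hu := hu
  · obtain ⟨w, hlt, hw⟩ := (((hend (-1) (by simp) (by norm_num)).filter_mono
      nhdsWithin_le_nhds).and (Ioo_mem_nhdsGT hρ.1)).exists
    have hw' : w ∈ Set.Ioo (-1) 1 := ⟨hw.1, hw.2.trans hρ.2⟩
    exact ⟨w, hw', (lt_corrRateReal_iff hρ hw' x).2 hlt, by nlinarith [hw.1, hw.2]⟩
  · obtain ⟨w, hlt, hw⟩ := (((hend 1 (by simp) (by norm_num)).filter_mono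
      nhdsWithin_le_nhds).and (Ioo_mem_nhdsLT hρ.2)).exists
    have hw' : w ∈ Set.Ioo (-1) 1 := ⟨hρ.1.trans hw.1, hw.2⟩
    exact ⟨w, hw', (lt_corrRateReal_iff hρ hw' x).2 hlt, by nlinarith [hw.1, hw.2]⟩

end RateFunction

/-! ### The Gram vector of correlated Gaussian pairs -/

section GramCGF

variable {ρ : ℝ}

/-- The determinant of `1 - 2 T Σ`, where `Σ` is the covariance matrix of two standard normal
variables of correlation `ρ` and `T` is the symmetric matrix of the quadratic form
`t 0 * x ^ 2 + t 1 * (x * y) + t 2 * y ^ 2`. -/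
def gramDet (ρ : ℝ) (t : Fin 3 → ℝ) : ℝ :=
  1 - 2 * t 0 - 2 * ρ * t 1 - 2 * t 2 + (1 - ρ ^ 2) * (4 * (t 0 * t 2) - t 1 ^ 2)

/-- The logarithm of the expectation of `exp (t 0 * x ^ 2 + t 1 * (x * y) + t 2 * y ^ 2)` for
standard normal variables `x` and `y` of correlation `ρ`. -/
noncomputable def gramCGF (ρ : ℝ) (t : Fin 3 → ℝ) : ℝ :=
  -(Real.log (gramDet ρ t) / 2)

/-- The domain of finiteness of `gramCGF ρ`: the vectors `t` for which the matrix `Σ⁻¹ - 2 T` of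
`gramDet` is positive definite. -/
def gramDomain (ρ : ℝ) : Set (Fin 3 → ℝ) :=
  {t | 0 < 1 - 2 * (1 - ρ ^ 2) * t 2 ∧ 0 < gramDet ρ t}

theorem isOpen_gramDomain (ρ : ℝ) : IsOpen (gramDomain ρ) := by
  have hdet : Continuous (gramDet ρ) := by
    unfold gramDet
    fun_prop
  have hdiag : Continuous fun t : Fin 3 → ℝ => 1 - 2 * (1 - ρ ^ 2) * t 2 := by fun_prop
  exact (isOpen_lt continuous_const hdiag).inter (isOpen_lt continuous_const hdet)

theorem gramDomain_mem_nhds_zero (ρ : ℝ) : gramDomain ρ ∈ 𝓝 0 :=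
  (isOpen_gramDomain ρ).mem_nhds (by simp [gramDomain, gramDet])

/-- The vector of `(Σ⁻¹ - S⁻¹) / 2` for `S = !![z 0, z 1; z 1, z 2]`: tilting by it turns the
Gaussian pair of covariance `Σ` into the one of covariance `S`. -/
noncomputable def gramTilt (ρ : ℝ) (z : Fin 3 → ℝ) : Fin 3 → ℝ :=
  ![(1 / (1 - ρ ^ 2) - z 2 / (z 0 * z 2 - z 1 ^ 2)) / 2,
    z 1 / (z 0 * z 2 - z 1 ^ 2) - ρ / (1 - ρ ^ 2),
    (1 / (1 - ρ ^ 2) - z 0 / (z 0 * z 2 - z 1 ^ 2)) / 2]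

variable {z : Fin 3 → ℝ}

theorem gramDet_gramTilt (hρ : 1 - ρ ^ 2 ≠ 0) (hz : z 0 * z 2 - z 1 ^ 2 ≠ 0) :
    gramDet ρ (gramTilt ρ z) = (1 - ρ ^ 2) / (z 0 * z 2 - z 1 ^ 2) := by
  simp only [gramDet, gramTilt, Matrix.cons_val]
  generalize hd : z 0 * z 2 - z 1 ^ 2 = d at *
  field_simp
  linear_combination 4 * (1 - ρ ^ 2) ^ 2 * hd

theorem gramTilt_mem_gramDomain (hρ : 0 < 1 - ρ ^ 2) (hz₀ : 0 < z 0)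
    (hz : 0 < z 0 * z 2 - z 1 ^ 2) : gramTilt ρ z ∈ gramDomain ρ := by
  have hdiag : 1 - 2 * (1 - ρ ^ 2) * gramTilt ρ z 2 =
      (1 - ρ ^ 2) * z 0 / (z 0 * z 2 - z 1 ^ 2) := by
    simp only [gramTilt, Matrix.cons_val]
    field_simp
    ring
  refine ⟨?_, ?_⟩
  · rw [hdiag]
    positivity
  · rw [gramDet_gramTilt hρ.ne' hz.ne']
    positivity

theorem hasLineDerivAt_gramDet (ρ : ℝ) (t : Fin 3 → ℝ) (i : Fin 3) :
    HasLineDerivAt ℝ (gramDet ρ)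
      (![4 * (1 - ρ ^ 2) * t 2 - 2, -(2 * (1 - ρ ^ 2) * t 1 + 2 * ρ), 4 * (1 - ρ ^ 2) * t 0 - 2] i)
      t (Pi.single i 1) := by
  have hcoord (j : Fin 3) : HasDerivAt (fun s : ℝ => (t + s • (Pi.single i 1 : Fin 3 → ℝ)) j)
      ((Pi.single i 1 : Fin 3 → ℝ) j) 0 := by
    simpa using ((hasDerivAt_id' (0 : ℝ)).mul_const ((Pi.single i 1 : Fin 3 → ℝ) j)).const_add (t j)
  have hlin := ((((hcoord 0).const_mul 2).const_sub 1).sub ((hcoord 1).const_mul (2 * ρ))).sub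
    ((hcoord 2).const_mul 2)
  have hquad := ((((hcoord 0).mul (hcoord 2)).const_mul 4).sub ((hcoord 1).pow 2)).const_mul
    (1 - ρ ^ 2)
  refine (hlin.add hquad).congr_deriv ?_
  fin_cases i <;> simp <;> ring

/-- The Gaussian pair of covariance `S` has Gram vector `z` on average. -/
theorem hasLineDerivAt_gramCGF_gramTilt (hρ : 1 - ρ ^ 2 ≠ 0) (hz : z 0 * z 2 - z 1 ^ 2 ≠ 0)
    (i : Fin 3) : HasLineDerivAt ℝ (gramCGF ρ) (z i) (gramTilt ρ z) (Pi.single i 1) := by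
  have hdet := gramDet_gramTilt hρ hz
  have hlog := (HasDerivAt.log (hasLineDerivAt_gramDet ρ (gramTilt ρ z) i)
    (by simpa [hdet] using ⟨hρ, hz⟩)).div_const 2 |>.neg
  refine hlog.congr_deriv ?_
  rw [zero_smul, add_zero, hdet]
  generalize hd : z 0 * z 2 - z 1 ^ 2 = d at *
  fin_cases i <;> simp [gramTilt, hd] <;> field_simp <;> ring

/-- The cheapest Gram vector of correlation `w` for which the ratio of the standard deviations is
that of `a` to `c`. -/
noncomputable def optimalGram (ρ w a c : ℝ) : Fin 3 → ℝ :=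
  ((1 - ρ ^ 2) / (1 - ρ * w)) • ![a / c, w, c / a]

variable {w a c : ℝ}

theorem optimalGram_det (ha : a ≠ 0) (hc : c ≠ 0) :
    optimalGram ρ w a c 0 * optimalGram ρ w a c 2 - optimalGram ρ w a c 1 ^ 2 =
      ((1 - ρ ^ 2) / (1 - ρ * w)) ^ 2 * (1 - w ^ 2) := by
  simp only [optimalGram, Pi.smul_apply, Matrix.cons_val, smul_eq_mul]
  field_simp

theorem optimalGram_det_pos (hρ : ρ ∈ Set.Ioo (-1) 1) (hw : w ∈ Set.Ioo (-1) 1) (ha : a ≠ 0)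
    (hc : c ≠ 0) :
    0 < optimalGram ρ w a c 0 * optimalGram ρ w a c 2 - optimalGram ρ w a c 1 ^ 2 := by
  have hq := one_sub_sq_pos hρ
  have hv := one_sub_mul_pos hρ (Set.Ioo_subset_Icc_self hw)
  have hw' := one_sub_sq_pos hw
  rw [optimalGram_det ha hc]
  positivity

theorem gramTilt_optimalGram_mem_gramDomain (hρ : ρ ∈ Set.Ioo (-1) 1) (hw : w ∈ Set.Ioo (-1) 1)
    (ha : 0 < a) (hc : 0 < c) : gramTilt ρ (optimalGram ρ w a c) ∈ gramDomain ρ := by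
  have hq := one_sub_sq_pos hρ
  have hv := one_sub_mul_pos hρ (Set.Ioo_subset_Icc_self hw)
  refine gramTilt_mem_gramDomain hq ?_ (optimalGram_det_pos hρ hw ha.ne' hc.ne')
  simp only [optimalGram, Pi.smul_apply, Matrix.cons_val, smul_eq_mul]
  positivity

theorem gramCGF_gramTilt_optimalGram (hρ : ρ ∈ Set.Ioo (-1) 1) (hw : w ∈ Set.Ioo (-1) 1)
    (ha : a ≠ 0) (hc : c ≠ 0) :
    gramCGF ρ (gramTilt ρ (optimalGram ρ w a c)) = -corrRateReal ρ w := by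
  have hq := (one_sub_sq_pos hρ).ne'
  have hv := (one_sub_mul_pos hρ (Set.Ioo_subset_Icc_self hw)).ne'
  rw [gramCGF, gramDet_gramTilt hq (optimalGram_det_pos hρ hw ha hc).ne', optimalGram_det ha hc,
    corrRateReal_eq_half_log hρ hw]
  congr 3
  field_simp

theorem gramTilt_optimalGram_dotProduct (hρ : ρ ∈ Set.Ioo (-1) 1) (hw : w ∈ Set.Ioo (-1) 1)
    (ha : a ≠ 0) (hc : c ≠ 0) (b : ℝ) :
    gramTilt ρ (optimalGram ρ w a c) ⬝ᵥ ![a ^ 2, b, c ^ 2] =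
      (a - c) ^ 2 / (2 * (1 - ρ ^ 2)) +
        (w - ρ) / ((1 - ρ ^ 2) * (1 - w ^ 2)) * (b - w * (a * c)) := by
  have hq := (one_sub_sq_pos hρ).ne'
  have hw' := (one_sub_sq_pos hw).ne'
  simp only [gramTilt, optimalGram, Pi.smul_apply, Matrix.cons_val, smul_eq_mul, dotProduct,
    Fin.sum_univ_three]
  field_simp
  ring

end GramCGF

/-! ### Large deviations of correlations -/

section ExponentialRates

variable {Ω : Type*} {mΩ : MeasurableSpace Ω} {P : Measure Ω} [IsFiniteMeasure P] {S : ℕ → Set Ω}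
  {c : EReal}

theorem limsup_log_measure_div_le
    (h : ∀ x : ℝ, (x : EReal) < c → ∀ᶠ n : ℕ in atTop, P.real (S n) ≤ Real.exp (-(n * x))) :
    limsup (fun n : ℕ => ENNReal.log (P (S n)) / ((n : ℝ) : EReal)) atTop ≤ -c := by
  rw [EReal.le_neg]
  refine EReal.ge_of_forall_gt_iff_ge.1 fun x hx => ?_
  rw [EReal.le_neg, ← EReal.coe_neg]
  refine limsup_le_of_le (by isBoundedDefault) ?_
  filter_upwards [h x hx, eventually_gt_atTop 0] with n hn hn0
  have hn' : (0 : ℝ) < n := by exact_mod_cast hn0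
  rw [EReal.div_le_iff_le_mul (by exact_mod_cast hn') (EReal.coe_ne_top _)]
  calc ENNReal.log (P (S n)) ≤ ENNReal.log (ENNReal.ofReal (Real.exp (-(n * x)))) := by
        rw [← ofReal_measureReal]
        gcongr
    _ = (n : ℝ) * ((-x : ℝ) : EReal) := by
        rw [ENNReal.log_ofReal_of_pos (Real.exp_pos _), Real.log_exp, ← EReal.coe_mul, mul_neg]

theorem le_liminf_log_measure_div
    (h : ∀ x : ℝ, c < (x : EReal) → ∀ᶠ n : ℕ in atTop, Real.exp (-(n * x)) ≤ P.real (S n)) :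
    -c ≤ liminf (fun n : ℕ => ENNReal.log (P (S n)) / ((n : ℝ) : EReal)) atTop := by
  rw [EReal.neg_le]
  refine EReal.le_of_forall_lt_iff_le.1 fun x hx => ?_
  rw [EReal.neg_le, ← EReal.coe_neg]
  refine le_liminf_of_le (by isBoundedDefault) ?_
  filter_upwards [h x hx, eventually_gt_atTop 0] with n hn hn0
  have hn' : (0 : ℝ) < n := by exact_mod_cast hn0
  rw [EReal.le_div_iff_mul_le (by exact_mod_cast hn') (EReal.coe_ne_top _)]
  calc ((-x : ℝ) : EReal) * (n : ℝ) = ENNReal.log (ENNReal.ofReal (Real.exp (-(n * x)))) := by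
        rw [ENNReal.log_ofReal_of_pos (Real.exp_pos _), Real.log_exp, ← EReal.coe_mul, neg_mul,
          mul_comm x]
    _ ≤ ENNReal.log (P (S n)) := by
        rw [← ofReal_measureReal (s := S n)]
        gcongr

end ExponentialRates

section GramCorr

/-- The correlation of a pair with Gram matrix `!![z 0, z 1; z 1, z 2]`, with value `0` if a
diagonal entry vanishes. -/
noncomputable def gramCorr (z : Fin 3 → ℝ) : ℝ :=
  z 1 / √(z 0 * z 2)

variable {ρ x δ : ℝ} {C : Set ℝ} {z y : Fin 3 → ℝ}

theorem continuousAt_gramCorr (h₀ : 0 < z 0) (h₂ : 0 < z 2) : ContinuousAt gramCorr z :=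
  (continuous_apply 1).continuousAt.div (by fun_prop) (by positivity)

theorem isClosed_setOf_gramCorr_mem (hδ : 0 < δ) (hC : IsClosed C) :
    IsClosed {y : Fin 3 → ℝ | (δ ≤ y 0 ∧ δ ≤ y 2) ∧ gramCorr y ∈ C} := by
  have hcont : ContinuousOn gramCorr {y | δ ≤ y 0 ∧ δ ≤ y 2} := fun y hy =>
    (continuousAt_gramCorr (hδ.trans_le hy.1) (hδ.trans_le hy.2)).continuousWithinAt
  refine hcont.preimage_isClosed_of_isClosed ?_ hC
  exact (isClosed_le continuous_const (continuous_apply 0)).inter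
    (isClosed_le continuous_const (continuous_apply 2))

/-- Tilting by `-s` in one diagonal direction makes that diagonal entry small. -/
theorem exists_pos_forall_le_lt_dotProduct_sub_gramCGF (hρ : ρ ∈ Set.Ioo (-1) 1) (x : ℝ) :
    ∃ δ > 0, ∀ y : Fin 3 → ℝ, y 0 ≤ δ ∨ y 2 ≤ δ →
      ∃ t ∈ gramDomain ρ, x < t ⬝ᵥ y - gramCGF ρ t := by
  have hlim : Tendsto (fun s : ℝ => Real.log (1 + 2 * s) / 2) atTop atTop :=
    (Real.tendsto_log_atTop.comp (tendsto_atTop_add_const_left _ 1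
      (tendsto_id.const_mul_atTop two_pos))).atTop_div_const two_pos
  obtain ⟨s, hs, hs0⟩ :=
    ((hlim.eventually_gt_atTop (x + 1)).and (eventually_gt_atTop 0)).exists
  have hq := one_sub_sq_pos hρ
  refine ⟨1 / s, by positivity, ?_⟩
  rintro y (hy | hy) <;> rw [le_div_iff₀ hs0] at hy
  · have hdet : gramDet ρ ![-s, 0, 0] = 1 + 2 * s := by simp [gramDet]
    have hdot : ![-s, 0, 0] ⬝ᵥ y = -(y 0 * s) := by simp [dotProduct, Fin.sum_univ_three, mul_comm]
    refine ⟨![-s, 0, 0], ⟨by simp, by rw [hdet]; positivity⟩, ?_⟩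
    rw [gramCGF, hdet, hdot]
    linarith
  · have hdet : gramDet ρ ![0, 0, -s] = 1 + 2 * s := by simp [gramDet]
    have hdot : ![0, 0, -s] ⬝ᵥ y = -(y 2 * s) := by simp [dotProduct, Fin.sum_univ_three, mul_comm]
    have hdiag : 1 - 2 * (1 - ρ ^ 2) * ![0, 0, -s] 2 = 1 + 2 * (1 - ρ ^ 2) * s := by simp
    refine ⟨![0, 0, -s], ⟨by rw [hdiag]; positivity, by rw [hdet]; positivity⟩, ?_⟩
    rw [gramCGF, hdet, hdot]
    linarith

theorem exists_lt_dotProduct_sub_gramCGF (hρ : ρ ∈ Set.Ioo (-1) 1) (h₀ : 0 < y 0) (h₂ : 0 < y 2)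
    (hx : (x : EReal) < corrRate ρ (gramCorr y)) :
    ∃ t ∈ gramDomain ρ, x < t ⬝ᵥ y - gramCGF ρ t := by
  obtain ⟨w, hw, hxw, hsign⟩ := exists_lt_corrRateReal hρ hx
  have ha : 0 < √(y 0) := Real.sqrt_pos.2 h₀
  have hc : 0 < √(y 2) := Real.sqrt_pos.2 h₂
  refine ⟨_, gramTilt_optimalGram_mem_gramDomain hρ hw ha hc, ?_⟩
  have hy : y = ![√(y 0) ^ 2, gramCorr y * (√(y 0) * √(y 2)), √(y 2) ^ 2] := by
    ext i
    fin_cases i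
    · simp [Real.sq_sqrt h₀.le]
    · simp [gramCorr, Real.sqrt_mul h₀.le, ha.ne', hc.ne']
    · simp [Real.sq_sqrt h₂.le]
  have hdot := gramTilt_optimalGram_dotProduct hρ hw ha.ne' hc.ne'
    (gramCorr y * (√(y 0) * √(y 2)))
  rw [← hy, ← sub_mul, ← mul_assoc, div_mul_eq_mul_div] at hdot
  have hdot_nonneg : 0 ≤ gramTilt ρ (optimalGram ρ w √(y 0) √(y 2)) ⬝ᵥ y := by
    have hq := one_sub_sq_pos hρ
    have hw' := one_sub_sq_pos hw
    rw [hdot]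
    positivity
  rw [gramCGF_gramTilt_optimalGram hρ hw ha.ne' hc.ne']
  linarith

variable {Ω : Type*} {mΩ : MeasurableSpace Ω} {P : Measure Ω} {Y : ℕ → Ω → Fin 3 → ℝ}
  {R : ℕ → Ω → ℝ}

theorem exists_eventually_measureReal_gramCorr_mem_le [IsFiniteMeasure P] (hρ : ρ ∈ Set.Ioo (-1) 1)
    (hY : ∀ᶠ n : ℕ in atTop, HasScaledCGFOn P n (Y n) (gramCGF ρ) (gramDomain ρ))
    (hC : IsClosed C) (hx : ∀ u ∈ C, (x : EReal) < corrRate ρ u) :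
    ∃ δ > 0, ∀ᶠ n : ℕ in atTop,
      P.real {ω | (δ ≤ Y n ω 0 ∧ δ ≤ Y n ω 2) → gramCorr (Y n ω) ∈ C} ≤ Real.exp (-(n * x)) := by
  obtain ⟨δ, hδ, hsmall⟩ := exists_pos_forall_le_lt_dotProduct_sub_gramCGF hρ x
  let F : Set (Fin 3 → ℝ) := {y | y 0 ≤ δ} ∪ {y | y 2 ≤ δ} ∪
    {y | (δ ≤ y 0 ∧ δ ≤ y 2) ∧ gramCorr y ∈ C}
  have hF : IsClosed F := ((isClosed_le (continuous_apply 0) continuous_const).union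
    (isClosed_le (continuous_apply 2) continuous_const)).union (isClosed_setOf_gramCorr_mem hδ hC)
  have hcost : ∀ y ∈ F, ∃ t ∈ gramDomain ρ, x < t ⬝ᵥ y - gramCGF ρ t := by
    rintro y (hy | ⟨⟨h₀, h₂⟩, hy⟩)
    · exact hsmall y hy
    · exact exists_lt_dotProduct_sub_gramCGF hρ (hδ.trans_le h₀) (hδ.trans_le h₂) (hx _ hy)
  obtain ⟨x', hx', hle⟩ :=
    exists_eventually_measureReal_isClosed_le hY hF (gramDomain_mem_nhds_zero ρ) hcost
  refine ⟨δ, hδ, hle.mono fun n hn => ?_⟩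
  refine (measureReal_mono fun ω hω => ?_).trans (hn.trans (by gcongr))
  change Y n ω ∈ F
  by_cases h : δ ≤ Y n ω 0 ∧ δ ≤ Y n ω 2
  · exact Or.inr ⟨h, hω h⟩
  · rw [not_and_or, not_le, not_le] at h
    exact Or.inl (h.imp le_of_lt le_of_lt)

/-- `R n` is uniformly close to the correlation of the Gram vector `Y n` as long as the diagonal
entries of `Y n` stay away from `0`. -/
def IsApproxCorr (P : Measure Ω) (Y : ℕ → Ω → Fin 3 → ℝ) (R : ℕ → Ω → ℝ) : Prop :=
  ∀ δ > 0, ∀ ε > 0, ∀ᶠ n in atTop, ∀ᵐ ω ∂P, δ ≤ Y n ω 0 ∧ δ ≤ Y n ω 2 →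
    |R n ω - gramCorr (Y n ω)| ≤ ε

theorem IsApproxCorr.eventually_measureReal_mem_le [IsFiniteMeasure P] (hρ : ρ ∈ Set.Ioo (-1) 1)
    (hR : IsApproxCorr P Y R)
    (hY : ∀ᶠ n : ℕ in atTop, HasScaledCGFOn P n (Y n) (gramCGF ρ) (gramDomain ρ)) {A : Set ℝ}
    (hx : (x : EReal) < ⨅ u ∈ closure A, corrRate ρ u) :
    ∀ᶠ n : ℕ in atTop, P.real {ω | R n ω ∈ A} ≤ Real.exp (-(n * x)) := by
  have hdisj : Disjoint {u | corrRate ρ u ≤ (x : EReal)} (closure A) :=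
    Set.disjoint_left.2 fun u hu hA => (hx.trans_le (biInf_le _ hA)).not_ge hu
  obtain ⟨ε, hε, hthick⟩ :=
    hdisj.exists_cthickenings (isCompact_setOf_corrRate_le hρ x) isClosed_closure
  obtain ⟨δ, hδ, hle⟩ := exists_eventually_measureReal_gramCorr_mem_le hρ hY
    (Metric.isClosed_cthickening (δ := ε) (E := closure A)) fun u hu => not_le.1 fun hux =>
      Set.disjoint_left.1 hthick (Metric.self_subset_cthickening _ hux) hu
  filter_upwards [hle, hR δ hδ ε hε] with n hn hRn
  refine (ENNReal.toReal_mono (measure_ne_top _ _) (measure_mono_ae ?_)).trans hn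
  filter_upwards [hRn] with ω hω hA hvol
  refine Metric.mem_cthickening_of_dist_le _ _ _ _ (subset_closure hA) ?_
  rw [dist_comm, Real.dist_eq]
  exact hω hvol

theorem eventually_exp_le_measureReal_gram [IsProbabilityMeasure P] (hρ : ρ ∈ Set.Ioo (-1) 1)
    (hY : ∀ᶠ n : ℕ in atTop, HasScaledCGFOn P n (Y n) (gramCGF ρ) (gramDomain ρ)) {u : ℝ}
    (hu : u ∈ Set.Ioo (-1) 1) (hx : corrRateReal ρ u < x) {U : Set (Fin 3 → ℝ)}
    (hU : U ∈ 𝓝 (optimalGram ρ u 1 1)) :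
    ∀ᶠ n : ℕ in atTop, Real.exp (-(n * x)) ≤ P.real {ω | Y n ω ∈ U} := by
  have hdot : gramTilt ρ (optimalGram ρ u 1 1) ⬝ᵥ optimalGram ρ u 1 1 = 0 := by
    have h := gramTilt_optimalGram_dotProduct hρ hu one_ne_zero one_ne_zero u
    conv_lhs => arg 2; rw [optimalGram]
    rw [dotProduct_smul]
    exact smul_eq_zero_of_right _ (by simpa using h)
  refine eventually_exp_le_measureReal (t := gramTilt ρ (optimalGram ρ u 1 1)) hY
    ((isOpen_gramDomain ρ).mem_nhds
      (gramTilt_optimalGram_mem_gramDomain hρ hu one_pos one_pos))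
    (hasLineDerivAt_gramCGF_gramTilt (one_sub_sq_pos hρ).ne'
      (optimalGram_det_pos hρ hu one_ne_zero one_ne_zero).ne') hU ?_
  rwa [hdot, gramCGF_gramTilt_optimalGram hρ hu one_ne_zero one_ne_zero, zero_sub, neg_neg]

theorem exists_pos_eventually_optimalGram_dist_gramCorr_lt (hρ : ρ ∈ Set.Ioo (-1) 1) {u ε : ℝ}
    (hu : u ∈ Set.Icc (-1) 1) (hε : 0 < ε) :
    ∃ δ > 0, ∀ᶠ y in 𝓝 (optimalGram ρ u 1 1), (δ ≤ y 0 ∧ δ ≤ y 2) ∧ dist (gramCorr y) u < ε := by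
  have hv : 0 < (1 - ρ ^ 2) / (1 - ρ * u) := div_pos (one_sub_sq_pos hρ) (one_sub_mul_pos hρ hu)
  set v := (1 - ρ ^ 2) / (1 - ρ * u) with hv_def
  have hz : optimalGram ρ u 1 1 = ![v, v * u, v] := by simp [optimalGram, ← hv_def]
  have hcorr : gramCorr ![v, v * u, v] = u := by simp [gramCorr, hv.le, hv.ne']
  have hcoord (i : Fin 3) (hi : ![v, v * u, v] i = v) :
      ∀ᶠ y : Fin 3 → ℝ in 𝓝 ![v, v * u, v], v / 2 ≤ y i :=
    (continuous_apply i).continuousAt.eventually_const_le (by simpa [hi] using hv)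
  have hcont : Tendsto gramCorr (𝓝 ![v, v * u, v]) (𝓝 u) :=
    (continuousAt_gramCorr hv hv).tendsto.trans_eq (congrArg 𝓝 hcorr)
  refine ⟨v / 2, half_pos hv, ?_⟩
  rw [hz]
  exact ((hcoord 0 rfl).and (hcoord 2 rfl)).and (hcont.eventually (Metric.ball_mem_nhds u hε))

theorem IsApproxCorr.eventually_exp_le_measureReal_mem [IsProbabilityMeasure P]
    (hρ : ρ ∈ Set.Ioo (-1) 1) (hR : IsApproxCorr P Y R)
    (hY : ∀ᶠ n : ℕ in atTop, HasScaledCGFOn P n (Y n) (gramCGF ρ) (gramDomain ρ)) {A : Set ℝ}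
    (hx : ⨅ u ∈ interior A, corrRate ρ u < (x : EReal)) :
    ∀ᶠ n : ℕ in atTop, Real.exp (-(n * x)) ≤ P.real {ω | R n ω ∈ A} := by
  obtain ⟨u, huA, hux⟩ : ∃ u, ∃ _ : u ∈ interior A, corrRate ρ u < x := by
    simpa only [iInf_lt_iff] using hx
  have hu : u ∈ Set.Ioo (-1) 1 := by
    by_contra hu
    exact not_top_lt (corrRate_of_notMem hu ▸ hux)
  rw [corrRate_of_mem hu, EReal.coe_lt_coe_iff] at hux
  obtain ⟨ε, hε, hball⟩ := Metric.isOpen_iff.1 isOpen_interior u huA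
  obtain ⟨δ, hδ, hU⟩ := exists_pos_eventually_optimalGram_dist_gramCorr_lt hρ
    (Set.Ioo_subset_Icc_self hu) (half_pos hε)
  filter_upwards [eventually_exp_le_measureReal_gram hρ hY hu hux hU,
    hR δ hδ (ε / 2) (half_pos hε)] with n hn hRn
  refine hn.trans (ENNReal.toReal_mono (measure_ne_top _ _) (measure_mono_ae ?_))
  filter_upwards [hRn] with ω hω hYU
  refine interior_subset (hball ?_)
  calc dist (R n ω) u ≤ dist (R n ω) (gramCorr (Y n ω)) + dist (gramCorr (Y n ω)) u :=
        dist_triangle _ _ _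
    _ < ε / 2 + ε / 2 := add_lt_add_of_le_of_lt (hω hYU.1) hYU.2
    _ = ε := add_halves ε

theorem IsApproxCorr.satisfiesLDP [IsProbabilityMeasure P] (hρ : ρ ∈ Set.Ioo (-1) 1)
    (hR : IsApproxCorr P Y R)
    (hY : ∀ᶠ n : ℕ in atTop, HasScaledCGFOn P n (Y n) (gramCGF ρ) (gramDomain ρ)) :
    SatisfiesLDP P R (fun n => (n : ℝ)) (corrRate ρ) where
  speed_tendsto := tendsto_natCast_atTop_atTop
  rate := (isGoodRateFunction_corrRate hρ).toIsRateFunction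
  lower _ _ := le_liminf_log_measure_div fun _ hx => hR.eventually_exp_le_measureReal_mem hρ hY hx
  upper _ _ := limsup_log_measure_div_le fun _ hx => hR.eventually_measureReal_mem_le hρ hY hx

end GramCorr

/-! ### Gaussian integrals -/

section GaussianPair

variable {v : NNReal} {α β κ : ℝ}

theorem gaussianPDFReal_mul_exp_quadratic (hv : v ≠ 0) (h : 0 < 1 - 2 * (κ * v)) (x : ℝ) :
    gaussianPDFReal 0 v x * Real.exp (β * x + κ * x ^ 2) =
      Real.exp (v * β ^ 2 / (2 * (1 - 2 * (κ * v))) - Real.log (1 - 2 * (κ * v)) / 2) *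
        gaussianPDFReal (v * β / (1 - 2 * (κ * v))) (v / (1 - 2 * (κ * v)).toNNReal) x := by
  have hv0 : (v : ℝ) ≠ 0 := by exact_mod_cast hv
  generalize hq : 1 - 2 * (κ * (v : ℝ)) = q at h
  have hκ : κ = (1 - q) / (2 * v) := by
    field_simp
    linarith
  have hsqrt : √(2 * Real.pi * (v / q)) = √(2 * Real.pi * v) / √q := by
    rw [← mul_div_assoc, Real.sqrt_div' _ h.le]
  have hexp : Real.exp (Real.log q / 2) = √q := by
    rw [← Real.log_sqrt h.le, Real.exp_log (Real.sqrt_pos.2 h)]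
  have hsq : -(x - 0) ^ 2 / (2 * v) + (β * x + κ * x ^ 2) =
      v * β ^ 2 / (2 * q) + -(x - v * β / q) ^ 2 / (2 * (v / q)) := by
    rw [hκ]
    field_simp
    ring
  rw [gaussianPDFReal, gaussianPDFReal, NNReal.coe_div, Real.coe_toNNReal _ h.le, mul_assoc,
    ← Real.exp_add, hsq, Real.exp_add, Real.exp_sub, hexp, hsqrt]
  have : √q ≠ 0 := (Real.sqrt_pos.2 h).ne'
  field_simp

theorem lintegral_exp_quadratic_gaussianReal (hv : v ≠ 0) (h : 0 < 1 - 2 * (κ * v)) :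
    ∫⁻ x, ENNReal.ofReal (Real.exp (β * x + κ * x ^ 2)) ∂(gaussianReal 0 v) =
      ENNReal.ofReal
        (Real.exp (v * β ^ 2 / (2 * (1 - 2 * (κ * v))) - Real.log (1 - 2 * (κ * v)) / 2)) := by
  have hw : v / (1 - 2 * (κ * v)).toNNReal ≠ 0 := div_ne_zero hv (by simpa using h)
  rw [gaussianReal_of_var_ne_zero 0 hv,
    lintegral_withDensity_eq_lintegral_mul _ (measurable_gaussianPDF 0 v) (by fun_prop)]
  simp only [Pi.mul_apply, gaussianPDF, ← ENNReal.ofReal_mul (gaussianPDFReal_nonneg _ _ _),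
    gaussianPDFReal_mul_exp_quadratic hv h]
  simp only [ENNReal.ofReal_mul (Real.exp_pos _).le]
  rw [lintegral_const_mul _ (by fun_prop), lintegral_gaussianPDFReal_eq_one _ hw, mul_one]

theorem lintegral_exp_quadForm_gaussianReal_prod (hv : v ≠ 0) (hκ : 0 < 1 - 2 * (κ * v))
    (hdet : 0 < (1 - 2 * (α * v)) * (1 - 2 * (κ * v)) - (β * v) ^ 2) :
    ∫⁻ z, ENNReal.ofReal (Real.exp (α * z.1 ^ 2 + β * (z.1 * z.2) + κ * z.2 ^ 2))
        ∂((gaussianReal 0 v).prod (gaussianReal 0 v)) =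
      ENNReal.ofReal
        (Real.exp (-(Real.log ((1 - 2 * (α * v)) * (1 - 2 * (κ * v)) - (β * v) ^ 2) / 2))) := by
  set q := 1 - 2 * (κ * v) with hq
  set α' := α + v * β ^ 2 / (2 * q) with hα'
  have hfactor : (1 - 2 * (α * v)) * q - (β * v) ^ 2 = q * (1 - 2 * (α' * v)) := by
    rw [hα']
    field_simp
    ring
  have hα'_pos : 0 < 1 - 2 * (α' * v) := (mul_pos_iff_of_pos_left hκ).1 (hfactor ▸ hdet)
  have hinner (x : ℝ) : ∫⁻ y, ENNReal.ofReal
        (Real.exp (α * x ^ 2 + β * (x * y) + κ * y ^ 2)) ∂(gaussianReal 0 v) =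
      ENNReal.ofReal (Real.exp (-(Real.log q / 2))) *
        ENNReal.ofReal (Real.exp (0 * x + α' * x ^ 2)) := by
    have hsplit (y : ℝ) : ENNReal.ofReal (Real.exp (α * x ^ 2 + β * (x * y) + κ * y ^ 2)) =
        ENNReal.ofReal (Real.exp (α * x ^ 2)) *
          ENNReal.ofReal (Real.exp (β * x * y + κ * y ^ 2)) := by
      rw [← ENNReal.ofReal_mul (Real.exp_pos _).le, ← Real.exp_add, add_assoc, mul_assoc β]
    simp only [hsplit]
    rw [lintegral_const_mul _ (by fun_prop), lintegral_exp_quadratic_gaussianReal hv hκ,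
      ← ENNReal.ofReal_mul (Real.exp_pos _).le, ← ENNReal.ofReal_mul (Real.exp_pos _).le,
      ← Real.exp_add, ← Real.exp_add, ← hq, hα']
    ring_nf
  rw [lintegral_prod _ (by fun_prop)]
  simp only [hinner]
  rw [lintegral_const_mul _ (by fun_prop), lintegral_exp_quadratic_gaussianReal hv hα'_pos,
    ← ENNReal.ofReal_mul (Real.exp_pos _).le, ← Real.exp_add, hfactor,
    Real.log_mul hκ.ne' hα'_pos.ne']
  ring_nf

variable {Ω : Type*} {mΩ : MeasurableSpace Ω} {P : Measure Ω} {U V : Ω → ℝ} {ρ r : ℝ}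

theorem hasScaledCGFOn_gram_of_indepFun [IsProbabilityMeasure P] (hρ : 0 ≤ 1 - ρ ^ 2)
    (hrv : r * v = 1) (hU : HasLaw U (gaussianReal 0 v) P) (hV : HasLaw V (gaussianReal 0 v) P)
    (hUV : IndepFun U V P) :
    HasScaledCGFOn P r (fun ω => ![U ω ^ 2, U ω * (ρ * U ω + √(1 - ρ ^ 2) * V ω),
      (ρ * U ω + √(1 - ρ ^ 2) * V ω) ^ 2]) (fun t => gramCGF ρ t / r) (gramDomain ρ) := by
  have hs := Real.sq_sqrt hρ
  set s := √(1 - ρ ^ 2)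
  have hv : v ≠ 0 := by
    rintro rfl
    simp at hrv
  have hr : r ≠ 0 := left_ne_zero_of_mul_eq_one hrv
  have hlaw := hUV.hasLaw_prod hU hV
  refine .of_lintegral_exp ?_ fun t ht => ?_
  · have hUm := hU.aemeasurable
    have hVm := hV.aemeasurable
    refine aemeasurable_pi_lambda _ fun i => ?_
    fin_cases i <;> dsimp <;> fun_prop
  · have hscale (x : ℝ) : r * x * v = x := by rw [mul_right_comm, hrv, one_mul]
    have hκ : 1 - 2 * (r * (s ^ 2 * t 2) * v) = 1 - 2 * (1 - ρ ^ 2) * t 2 := by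
      rw [hscale, hs, mul_assoc]
    have hdet : (1 - 2 * (r * (t 0 + ρ * t 1 + ρ ^ 2 * t 2) * v)) *
        (1 - 2 * (r * (s ^ 2 * t 2) * v)) - (r * (s * (t 1 + 2 * ρ * t 2)) * v) ^ 2 =
          gramDet ρ t := by
      rw [hscale, hscale, hscale, mul_pow, hs, gramDet]
      ring
    have hlint := hlaw.lintegral_comp (f := fun z => ENNReal.ofReal (Real.exp
        (r * (t 0 + ρ * t 1 + ρ ^ 2 * t 2) * z.1 ^ 2 + r * (s * (t 1 + 2 * ρ * t 2)) *
          (z.1 * z.2) + r * (s ^ 2 * t 2) * z.2 ^ 2))) (by fun_prop)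
    rw [lintegral_exp_quadForm_gaussianReal_prod hv (hκ ▸ ht.1) (hdet ▸ ht.2), hdet] at hlint
    rw [mul_div_cancel₀ _ hr, gramCGF, ← hlint]
    refine lintegral_congr fun ω => ?_
    congr 2
    simp only [dotProduct, Fin.sum_univ_three, Matrix.cons_val]
    ring

end GaussianPair

/-! ### Increments of Brownian motion -/

theorem iIndepFun_prodMk_of_indepFun {Ω ι α β : Type*} {mΩ : MeasurableSpace Ω} {P : Measure Ω}
    [Finite ι] [MeasurableSpace α] [MeasurableSpace β] {X : ι → Ω → α} {Y : ι → Ω → β}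
    (hXm : ∀ i, AEMeasurable (X i) P) (hYm : ∀ i, AEMeasurable (Y i) P)
    (hX : iIndepFun X P) (hY : iIndepFun Y P)
    (hXY : IndepFun (fun ω i => X i ω) (fun ω i => Y i ω) P) :
    iIndepFun (fun i ω => (X i ω, Y i ω)) P := by
  cases nonempty_fintype ι
  have := hX.isProbabilityMeasure
  have hXlaw (i : ι) : HasLaw (X i) (P.map (X i)) P := ⟨hXm i, rfl⟩
  have hYlaw (i : ι) : HasLaw (Y i) (P.map (Y i)) P := ⟨hYm i, rfl⟩
  have (i : ι) := Measure.isProbabilityMeasure_map (hXm i)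
  have (i : ι) := Measure.isProbabilityMeasure_map (hYm i)
  have hpair (i : ι) : IndepFun (X i) (Y i) P :=
    hXY.comp (measurable_pi_apply i) (measurable_pi_apply i)
  refine (iIndepFun_iff_hasLaw_pi_pi fun i => (hpair i).hasLaw_prod (hXlaw i) (hYlaw i)).2 ?_
  exact (measurePreserving_arrowProdEquivProdArrow _ _ _ _ _).symm.comp_hasLaw
    (hXY.hasLaw_prod (hX.hasLaw_pi hXlaw) (hY.hasLaw_pi hYlaw))

section Increments

variable {Ω : Type*} {X Y B B' : ℝ → Ω → ℝ} {n k : ℕ}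

theorem natCast_div_mem_Icc (hk : k ≤ n) : (k : ℝ) / n ∈ Set.Icc (0 : ℝ) 1 :=
  ⟨by positivity, div_le_one_of_le₀ (by exact_mod_cast hk) (by positivity)⟩

theorem increment_succ (X : ℝ → Ω → ℝ) (n k : ℕ) :
    increment X n (k + 1) = fun ω => X (((k + 1 : ℕ) : ℝ) / n) ω - X ((k : ℝ) / n) ω := by
  funext ω
  simp [increment]

theorem sum_Icc_floor_mul_one (n : ℕ) (f : ℕ → ℝ) :
    ∑ k ∈ Finset.Icc 1 ⌊(n : ℝ) * 1⌋₊, f k = ∑ i : Fin n, f (i + 1) := by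
  rw [mul_one, Nat.floor_natCast, Fin.sum_univ_eq_sum_range (fun i => f (i + 1)),
    Finset.range_eq_Ico, Finset.sum_Ico_add', zero_add, Finset.Ico_add_one_right_eq_Icc]

/-- The realized volatilities and covolatility on `[0, 1]`, as the entries
`![z₁₁, z₁₂, z₂₂]` of the Gram matrix of the two vectors of increments. -/
noncomputable def realizedGram (X Y : ℝ → Ω → ℝ) (n : ℕ) (ω : Ω) : Fin 3 → ℝ :=
  ![realizedVol X 1 n ω, realizedCov X Y 1 n ω, realizedVol Y 1 n ω]

theorem realizedGram_eq_sum (X Y : ℝ → Ω → ℝ) (n : ℕ) :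
    realizedGram X Y n = ∑ i : Fin n, fun ω => ![increment X n (i + 1) ω ^ 2,
      increment X n (i + 1) ω * increment Y n (i + 1) ω, increment Y n (i + 1) ω ^ 2] := by
  ext ω j
  rw [Finset.sum_apply, Finset.sum_apply]
  fin_cases j <;> exact sum_Icc_floor_mul_one n _

variable {mΩ : MeasurableSpace Ω} {P : Measure Ω} {ρ : ℝ}

theorem IsUnitBrownian.hasLaw_increment (hB : IsUnitBrownian P B) (hk : k < n) :
    HasLaw (increment B n (k + 1)) (gaussianReal 0 (1 / n)) P := by
  have h := hB.law ((k : ℝ) / n) (((k + 1 : ℕ) : ℝ) / n) (natCast_div_mem_Icc hk.le).1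
    (by gcongr; exact k.le_succ) (natCast_div_mem_Icc hk).2
  have hvar : ((((k + 1 : ℕ) : ℝ) / n - k / n).toNNReal) = 1 / n := by
    rw [← sub_div, Nat.cast_succ, add_sub_cancel_left, Real.toNNReal_div zero_le_one,
      Real.toNNReal_one, Real.toNNReal_natCast]
  rwa [hvar, ← increment_succ] at h

theorem IsUnitBrownian.iIndepFun_increment (hB : IsUnitBrownian P B) (n : ℕ) :
    iIndepFun (fun (i : Fin n) => increment B n (i + 1)) P := by
  have h := hB.indep n (fun i => ⟨((i : ℕ) : ℝ) / n, natCast_div_mem_Icc (by omega)⟩)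
    fun i j hij => by
      simp only [Subtype.mk_le_mk]
      gcongr
      exact_mod_cast hij
  convert h using 2 with i
  rw [increment_succ]
  simp

theorem IndepUnitProcesses.indepFun_increments (h : IndepUnitProcesses P B B') (n : ℕ) :
    IndepFun (fun ω (i : Fin n) => increment B n (i + 1) ω)
      (fun ω (i : Fin n) => increment B' n (i + 1) ω) P := by
  let φ : (Set.Icc (0 : ℝ) 1 → ℝ) → Fin n → ℝ := fun f i =>
    f ⟨((i + 1 : ℕ) : ℝ) / n, natCast_div_mem_Icc (by omega)⟩ -
      f ⟨((i : ℕ) : ℝ) / n, natCast_div_mem_Icc (by omega)⟩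
  have hφ : Measurable φ := by fun_prop
  convert IndepFun.comp h hφ hφ using 1 <;>
    · funext ω i
      rw [increment_succ]
      rfl

theorem hasScaledCGFOn_realizedGram (hρ : 0 ≤ 1 - ρ ^ 2) (hB : IsUnitBrownian P B)
    (hB' : IsUnitBrownian P B') (hind : IndepUnitProcesses P B B') (hn : 0 < n) :
    HasScaledCGFOn P n (realizedGram B (fun t ω => ρ * B t ω + √(1 - ρ ^ 2) * B' t ω) n)
      (gramCGF ρ) (gramDomain ρ) := by
  have := (hB.iIndepFun_increment n).isProbabilityMeasure
  have hn' : (n : ℝ) ≠ 0 := by exact_mod_cast hn.ne'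
  set s := √(1 - ρ ^ 2)
  have hinc (k : ℕ) (ω : Ω) : increment (fun t ω => ρ * B t ω + s * B' t ω) n k ω =
      ρ * increment B n k ω + s * increment B' n k ω := by
    simp only [increment]
    ring
  have hpairs := hind.indepFun_increments n
  have hindep := (iIndepFun_prodMk_of_indepFun (fun i => (hB.hasLaw_increment i.2).aemeasurable)
    (fun i => (hB'.hasLaw_increment i.2).aemeasurable) (hB.iIndepFun_increment n)
    (hB'.iIndepFun_increment n) hpairs).comp (fun _ p => ![p.1 ^ 2, p.1 * (ρ * p.1 + s * p.2),
      (ρ * p.1 + s * p.2) ^ 2]) fun _ => measurable_pi_lambda _ fun j => by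
        fin_cases j <;> dsimp <;> fun_prop
  have hCGF : ∑ _i : Fin n, (fun t => gramCGF ρ t / n) = gramCGF ρ := by
    ext t
    simp only [Finset.sum_apply, Finset.sum_const, Finset.card_univ, Fintype.card_fin,
      nsmul_eq_mul, mul_div_cancel₀ _ hn']
  simp only [realizedGram_eq_sum, hinc]
  rw [← hCGF]
  refine .sum hindep fun i => ?_
  exact hasScaledCGFOn_gram_of_indepFun hρ (by simp [hn'])
    (hB.hasLaw_increment i.2) (hB'.hasLaw_increment i.2)
    (hpairs.comp (measurable_pi_apply i) (measurable_pi_apply i))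

end Increments

/-! ### Perturbation by a bounded drift -/

section Normalize

open NormedSpace (normalize)

variable {E : Type*} [NormedAddCommGroup E]

theorem norm_normalize_le_one [NormedSpace ℝ E] (x : E) : ‖normalize x‖ ≤ 1 := by
  rw [NormedSpace.normalize, norm_smul, norm_inv, norm_norm]
  exact inv_mul_le_one

theorem norm_normalize_sub_normalize_le [NormedSpace ℝ E] (x : E) {y : E} (hy : y ≠ 0) :
    ‖normalize x - normalize y‖ ≤ 2 * (‖x - y‖ / ‖y‖) := by
  have hy_pos : 0 < ‖y‖ := norm_pos_iff.2 hy
  have hsplit : ‖y‖ • (normalize x - normalize y) = (‖y‖ - ‖x‖) • normalize x + (x - y) := by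
    rw [smul_sub, sub_smul, NormedSpace.norm_smul_normalize, NormedSpace.norm_smul_normalize]
    abel
  rw [← mul_div_assoc, le_div_iff₀' hy_pos]
  calc ‖y‖ * ‖normalize x - normalize y‖ = ‖(‖y‖ - ‖x‖) • normalize x + (x - y)‖ := by
        rw [← hsplit, norm_smul, norm_norm]
    _ ≤ |‖y‖ - ‖x‖| * ‖normalize x‖ + ‖x - y‖ := by
        rw [← Real.norm_eq_abs, ← norm_smul]
        exact norm_add_le _ _
    _ ≤ ‖x - y‖ * 1 + ‖x - y‖ := by
        gcongr
        · exact norm_sub_rev x y ▸ abs_norm_sub_norm_le y x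
        · exact norm_normalize_le_one x
    _ = 2 * ‖x - y‖ := by ring

theorem abs_inner_normalize_sub_le [InnerProductSpace ℝ E] (x x' : E) {y y' : E} (hy : y ≠ 0)
    (hy' : y' ≠ 0) :
    |inner ℝ (normalize x) (normalize x') - inner ℝ (normalize y) (normalize y')| ≤
      2 * (‖x - y‖ / ‖y‖) + 2 * (‖x' - y'‖ / ‖y'‖) := by
  have hsplit : inner ℝ (normalize x) (normalize x') - inner ℝ (normalize y) (normalize y') =
      inner ℝ (normalize x - normalize y) (normalize x') +
        inner ℝ (normalize y) (normalize x' - normalize y') := by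
    rw [inner_sub_left, inner_sub_right]
    ring
  calc |inner ℝ (normalize x) (normalize x') - inner ℝ (normalize y) (normalize y')|
      ≤ ‖normalize x - normalize y‖ * ‖normalize x'‖ +
          ‖normalize y‖ * ‖normalize x' - normalize y'‖ := by
        rw [hsplit]
        exact (abs_add_le _ _).trans
          (add_le_add (abs_real_inner_le_norm _ _) (abs_real_inner_le_norm _ _))
    _ ≤ 2 * (‖x - y‖ / ‖y‖) * 1 + 1 * (2 * (‖x' - y'‖ / ‖y'‖)) := by
        gcongr
        · exact norm_normalize_sub_normalize_le x hy
        · exact norm_normalize_le_one x'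
        · exact norm_normalize_le_one y
        · exact norm_normalize_sub_normalize_le x' hy'
    _ = 2 * (‖x - y‖ / ‖y‖) + 2 * (‖x' - y'‖ / ‖y'‖) := by rw [mul_one, one_mul]

end Normalize

section IncrementVec

open NormedSpace (normalize)

variable {Ω : Type*} {X Y B B' : ℝ → Ω → ℝ} {σ σ' C C' δ : ℝ} {n : ℕ} {ω : Ω}

/-- The increments of `X` over the `n` intervals of the grid on `[0, 1]`, as a Euclidean vector. -/
noncomputable def incrementVec (X : ℝ → Ω → ℝ) (n : ℕ) (ω : Ω) : EuclideanSpace ℝ (Fin n) :=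
  WithLp.toLp 2 fun i => increment X n (i + 1) ω

theorem realizedCov_eq_inner (X Y : ℝ → Ω → ℝ) (n : ℕ) (ω : Ω) :
    realizedCov X Y 1 n ω = inner ℝ (incrementVec X n ω) (incrementVec Y n ω) := by
  rw [realizedCov, sum_Icc_floor_mul_one n fun k => increment X n k ω * increment Y n k ω,
    PiLp.inner_apply]
  exact Finset.sum_congr rfl fun i _ => mul_comm _ _

theorem realizedVol_eq_norm_sq (X : ℝ → Ω → ℝ) (n : ℕ) (ω : Ω) :
    realizedVol X 1 n ω = ‖incrementVec X n ω‖ ^ 2 := by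
  rw [← real_inner_self_eq_norm_sq, ← realizedCov_eq_inner]
  simp only [realizedCov, realizedVol, sq]

theorem realizedCorr_eq_inner_normalize (X Y : ℝ → Ω → ℝ) (n : ℕ) (ω : Ω) :
    realizedCorr X Y 1 n ω =
      inner ℝ (normalize (incrementVec X n ω)) (normalize (incrementVec Y n ω)) := by
  rw [realizedCorr, realizedVol_eq_norm_sq, realizedVol_eq_norm_sq, ← mul_pow,
    Real.sqrt_sq (by positivity), realizedCov_eq_inner, NormedSpace.normalize,
    NormedSpace.normalize, real_inner_smul_left, real_inner_smul_right, ← mul_assoc, ← mul_inv,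
    inv_mul_eq_div]

theorem norm_incrementVec_sub_smul_le (hC : 0 ≤ C)
    (h : ∀ k < n, |increment X n (k + 1) ω - σ * increment B n (k + 1) ω| ≤ C / n) :
    ‖incrementVec X n ω - σ • incrementVec B n ω‖ ≤ C / √n := by
  rw [EuclideanSpace.norm_eq, Real.sqrt_le_iff]
  refine ⟨by positivity, ?_⟩
  calc ∑ i, ‖(incrementVec X n ω - σ • incrementVec B n ω) i‖ ^ 2
      ≤ ∑ _i : Fin n, (C / n) ^ 2 := by
        gcongr with i
        exact h i i.2
    _ = (C / √n) ^ 2 := by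
        rw [Finset.sum_const, Finset.card_univ, Fintype.card_fin, nsmul_eq_mul, div_pow, div_pow,
          Real.sq_sqrt n.cast_nonneg]
        field_simp

theorem norm_incrementVec_sub_smul_div_le (hσ : 0 < σ) (hC : 0 ≤ C) (hδ : 0 < δ)
    (h : ∀ k < n, |increment X n (k + 1) ω - σ * increment B n (k + 1) ω| ≤ C / n)
    (hB : δ ≤ realizedVol B 1 n ω) :
    σ • incrementVec B n ω ≠ 0 ∧
      ‖incrementVec X n ω - σ • incrementVec B n ω‖ / ‖σ • incrementVec B n ω‖ ≤
        C / (σ * √δ) / √n := by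
  have hnorm : √δ ≤ ‖incrementVec B n ω‖ :=
    Real.sqrt_le_iff.2 ⟨norm_nonneg _, realizedVol_eq_norm_sq B n ω ▸ hB⟩
  have hsmul : σ * √δ ≤ ‖σ • incrementVec B n ω‖ := by
    rw [norm_smul, Real.norm_of_nonneg hσ.le]
    gcongr
  have hpos : 0 < σ * √δ := mul_pos hσ (Real.sqrt_pos.2 hδ)
  refine ⟨norm_pos_iff.1 (hpos.trans_le hsmul), ?_⟩
  rw [div_right_comm]
  gcongr
  exact norm_incrementVec_sub_smul_le hC h

theorem abs_realizedCorr_sub_le (hσ : 0 < σ) (hσ' : 0 < σ') (hC : 0 ≤ C) (hC' : 0 ≤ C')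
    (hδ : 0 < δ)
    (h : ∀ k < n, |increment X n (k + 1) ω - σ * increment B n (k + 1) ω| ≤ C / n)
    (h' : ∀ k < n, |increment Y n (k + 1) ω - σ' * increment B' n (k + 1) ω| ≤ C' / n)
    (hB : δ ≤ realizedVol B 1 n ω) (hB' : δ ≤ realizedVol B' 1 n ω) :
    |realizedCorr X Y 1 n ω - realizedCorr B B' 1 n ω| ≤
      2 * (C / (σ * √δ) + C' / (σ' * √δ)) / √n := by
  obtain ⟨hne, hle⟩ := norm_incrementVec_sub_smul_div_le hσ hC hδ h hB
  obtain ⟨hne', hle'⟩ := norm_incrementVec_sub_smul_div_le hσ' hC' hδ h' hB'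
  rw [realizedCorr_eq_inner_normalize, realizedCorr_eq_inner_normalize,
    ← NormedSpace.normalize_smul_of_pos hσ (incrementVec B n ω),
    ← NormedSpace.normalize_smul_of_pos hσ' (incrementVec B' n ω)]
  refine (abs_inner_normalize_sub_le _ _ hne hne').trans ?_
  rw [← mul_add, mul_div_assoc, add_div]
  gcongr

end IncrementVec

section Drift

theorem exists_ae_norm_le_of_memLp_top {α F : Type*} [NormedAddCommGroup F]
    {mα : MeasurableSpace α} {μ : Measure α} {f : α → F} (hf : MemLp f ∞ μ) :
    ∃ C, 0 ≤ C ∧ ∀ᵐ x ∂μ, ‖f x‖ ≤ C := by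
  have hfinite : eLpNormEssSup f μ ≠ ∞ := eLpNorm_exponent_top (f := f) ▸ hf.eLpNorm_ne_top
  refine ⟨(eLpNormEssSup f μ).toReal, ENNReal.toReal_nonneg, ?_⟩
  filter_upwards [ae_le_eLpNormEssSup (f := f)] with x hx
  rw [← toReal_enorm]
  exact ENNReal.toReal_mono hfinite hx

variable {Ω : Type*} {mΩ : MeasurableSpace Ω} {P : Measure Ω} {σ σ₁ σ₂ : ℝ}
  {B B' B₁ B₂ b b₁ b₂ X X₁ X₂ : ℝ → Ω → ℝ}

theorem BoundedDrift.exists_abs_le [SFinite P] (hb : BoundedDrift P b) :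
    ∃ C, 0 ≤ C ∧ ∀ᵐ ω ∂P, AEStronglyMeasurable (fun s => b s ω) (volume.restrict (Set.Icc 0 1)) ∧
      ∀ᵐ s ∂volume.restrict (Set.Icc (0 : ℝ) 1), |b s ω| ≤ C := by
  have hswap : MemLp (fun p : Ω × ℝ => b p.2 p.1) ∞
      (P.prod (volume.restrict (Set.Icc (0 : ℝ) 1))) :=
    hb.comp_measurePreserving Measure.measurePreserving_swap
  obtain ⟨C, hC, hbound⟩ := exists_ae_norm_le_of_memLp_top hswap
  refine ⟨C, hC, ?_⟩
  filter_upwards [hswap.aestronglyMeasurable.prodMk_left,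
    Measure.ae_ae_of_ae_prod hbound] with ω hmeas hω
  exact ⟨hmeas, hω⟩

theorem BoundedDrift.exists_abs_integral_le [SFinite P] (hb : BoundedDrift P b) :
    ∃ C, 0 ≤ C ∧ ∀ᵐ ω ∂P, ∀ s t : ℝ, 0 ≤ s → s ≤ t → t ≤ 1 →
      |(∫ r in (0 : ℝ)..t, b r ω) - ∫ r in (0 : ℝ)..s, b r ω| ≤ C * (t - s) := by
  obtain ⟨C, hC, h⟩ := hb.exists_abs_le
  refine ⟨C, hC, ?_⟩
  filter_upwards [h] with ω ⟨hmeas, hbound⟩ s t hs hst ht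
  have hint : IntegrableOn (fun r => b r ω) (Set.Icc 0 1) :=
    .of_bound measure_Icc_lt_top hmeas C hbound
  have hinterval {u v : ℝ} (hu : u ∈ Set.Icc (0 : ℝ) 1) (hv : v ∈ Set.Icc (0 : ℝ) 1) :
      IntervalIntegrable (fun r => b r ω) volume u v :=
    intervalIntegrable_iff.2
      (hint.mono_set (Set.uIoc_subset_uIcc.trans (Set.uIcc_subset_Icc hu hv)))
  have h0 : (0 : ℝ) ∈ Set.Icc (0 : ℝ) 1 := Set.left_mem_Icc.2 zero_le_one
  have hs' : s ∈ Set.Icc (0 : ℝ) 1 := ⟨hs, hst.trans ht⟩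
  have ht' : t ∈ Set.Icc (0 : ℝ) 1 := ⟨hs.trans hst, ht⟩
  rw [intervalIntegral.integral_interval_sub_left (hinterval h0 ht') (hinterval h0 hs'),
    ← abs_of_nonneg (sub_nonneg.2 hst)]
  refine intervalIntegral.norm_integral_le_of_norm_le_const_ae (f := fun r => b r ω) ?_
  filter_upwards [(ae_restrict_iff' measurableSet_Icc).1 hbound] with r hr hrst
  exact hr (Set.uIcc_subset_Icc hs' ht' (Set.uIoc_subset_uIcc hrst))

theorem IsItoProcess.congr (hX : IsItoProcess P σ B b X)
    (h : ∀ t : ℝ, 0 ≤ t → t ≤ 1 → ∀ᵐ ω ∂P, B t ω = B' t ω) : IsItoProcess P σ B' b X := by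
  intro t ht ht'
  filter_upwards [hX t ht ht', h t ht ht', h 0 le_rfl zero_le_one] with ω hXt hBt hB0
  rw [hXt, hBt, hB0]

theorem IsItoProcess.exists_abs_increment_sub_le [SFinite P] (hX : IsItoProcess P σ B b X)
    (hb : BoundedDrift P b) :
    ∃ C, 0 ≤ C ∧ ∀ n : ℕ, ∀ᵐ ω ∂P, ∀ k < n,
      |increment X n (k + 1) ω - σ * increment B n (k + 1) ω| ≤ C / n := by
  obtain ⟨C, hC, hdrift⟩ := hb.exists_abs_integral_le
  refine ⟨C, hC, fun n => ?_⟩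
  simp only [← Finset.mem_range]
  rw [Filter.eventually_all_finset]
  intro k hk
  have hleft := natCast_div_mem_Icc (Finset.mem_range.1 hk).le
  have hright := natCast_div_mem_Icc (n := n) (k := k + 1) (Finset.mem_range.1 hk)
  filter_upwards [hdrift, hX _ hleft.1 hleft.2, hX _ hright.1 hright.2] with ω hω hXl hXr
  calc |increment X n (k + 1) ω - σ * increment B n (k + 1) ω|
      = |(∫ r in (0 : ℝ)..((k + 1 : ℕ) : ℝ) / n, b r ω) - ∫ r in (0 : ℝ)..k / n, b r ω| := by
        simp only [increment_succ, hXl, hXr]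
        congr 1
        ring
    _ ≤ C * (((k + 1 : ℕ) : ℝ) / n - k / n) :=
        hω _ _ hleft.1 (by gcongr; exact k.le_succ) hright.2
    _ = C / n := by
        push_cast
        ring

theorem isApproxCorr_realizedCorr [SFinite P] (hσ₁ : 0 < σ₁) (hσ₂ : 0 < σ₂)
    (hb₁ : BoundedDrift P b₁) (hb₂ : BoundedDrift P b₂) (hX₁ : IsItoProcess P σ₁ B₁ b₁ X₁)
    (hX₂ : IsItoProcess P σ₂ B₂ b₂ X₂) :
    IsApproxCorr P (realizedGram B₁ B₂) (realizedCorr X₁ X₂ 1) := by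
  obtain ⟨C₁, hC₁, h₁⟩ := hX₁.exists_abs_increment_sub_le hb₁
  obtain ⟨C₂, hC₂, h₂⟩ := hX₂.exists_abs_increment_sub_le hb₂
  intro δ hδ ε hε
  have hlim : Tendsto (fun n : ℕ => 2 * (C₁ / (σ₁ * √δ) + C₂ / (σ₂ * √δ)) / √(n : ℝ)) atTop
      (𝓝 0) :=
    (Real.tendsto_sqrt_atTop.comp tendsto_natCast_atTop_atTop).const_div_atTop _
  filter_upwards [hlim.eventually (eventually_le_nhds hε)] with n hn
  filter_upwards [h₁ n, h₂ n] with ω hω₁ hω₂ ⟨hvol₁, hvol₂⟩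
  exact (abs_realizedCorr_sub_le hσ₁ hσ₂ hC₁ hC₂ hδ hω₁ hω₂ hvol₁ hvol₂).trans hn

end Drift

theorem mainTheorem8 {Ω : Type*} [MeasurableSpace Ω] (P : Measure Ω) [IsProbabilityMeasure P]
    (σ₁ σ₂ ρ : ℝ) (hσ₁ : 0 < σ₁) (hσ₂ : 0 < σ₂) (hρ : -1 < ρ) (hρ' : ρ < 1)
    (B₁ B₂ B₃ : ℝ → Ω → ℝ)
    (hB₁ : IsUnitBrownian P B₁) (hB₃ : IsUnitBrownian P B₃) (hind : IndepUnitProcesses P B₁ B₃)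
    (hB₂ : ∀ t : ℝ, 0 ≤ t → t ≤ 1 →
      ∀ᵐ ω ∂P, B₂ t ω = ρ * B₁ t ω + √(1 - ρ ^ 2) * B₃ t ω)
    (b₁ b₂ : ℝ → Ω → ℝ) (hb₁ : BoundedDrift P b₁) (hb₂ : BoundedDrift P b₂)
    (X₁ X₂ : ℝ → Ω → ℝ)
    (hX₁ : IsItoProcess P σ₁ B₁ b₁ X₁) (hX₂ : IsItoProcess P σ₂ B₂ b₂ X₂) :
    IsGoodRateFunction (corrRate ρ) ∧
      SatisfiesLDP P (fun n => realizedCorr X₁ X₂ 1 n) (fun n => (n : ℝ)) (corrRate ρ) := by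
  have hρ_mem : ρ ∈ Set.Ioo (-1) 1 := ⟨hρ, hρ'⟩
  have happrox : IsApproxCorr P (realizedGram B₁ fun t ω => ρ * B₁ t ω + √(1 - ρ ^ 2) * B₃ t ω)
      (realizedCorr X₁ X₂ 1) :=
    isApproxCorr_realizedCorr hσ₁ hσ₂ hb₁ hb₂ hX₁ (hX₂.congr hB₂)
  refine ⟨isGoodRateFunction_corrRate hρ_mem, happrox.satisfiesLDP hρ_mem ?_⟩
  filter_upwards [eventually_gt_atTop 0] with n hn
  exact hasScaledCGFOn_realizedGram (one_sub_sq_pos hρ_mem).le hB₁ hB₃ hind hn
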